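/- **Setting.** Let $\dot x(t)=f(x(t),u(t))$, $x(0)=x_0\in G$, with controls $u(\cdot)\in\mathcal U=L^\infty_{\mathrm{loc}}([0,+\infty),U)$ (measurable, locally essentially bounded, $U$-valued) and Carathéodory solutions $x(\cdot;x_0,u(\cdot))$. $B_r$, $\bar B_r$ are the open and closed Euclidean balls of radius $r$ about $0$; an open domain is a nonempty open connected set; $\varphi:\Xi\to\mathbb R$ is proper if preimages of compact sets are compact, and positive definite if $\varphi(0)=0$ and $\varphi>0$ on $\Xi\setminus\{0\}$; $\partial^-\varphi(x;v)=\liminf_{\lambda\to0+,\,w\to v}\frac{\varphi(x+\lambda w)-\varphi(x)}{\lambda}$ is the lower Dini derivative. Assume: **(A) System.** (1) $U\subset\mathbb R^m$ is compact, $G,G_1\subseteq\mathbb R^n$ are open domains, $\bar G\subseteq G_1$, $0\in G$. (2) $f:G_1\times U\to\mathbb R^n$ is continuous. (3) Every solution in $G_1$ on an interval $[0,T)$, $0<T\le+\infty$, with $x_0\in G$ and $u(\cdot)\in\mathcal U$ stays in $G$. (4) For each $R>0$ there is $C_{1,R}>0$ with $\|f(x,u)-f(x',u)\|\le C_{1,R}\|x-x'\|$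 for $x,x'\in\bar B_R\cap\bar G$, $u\in U$. (5) There are a $C^1$ proper function $Y:G_1\to[0,+\infty)$ and $C_2>0$ with $\sup_{u\in U}\langle \mathrm DY(x),f(x,u)\rangle\le C_2Y(x)$ for all $x\in G_1$. **(B) Local control Lyapunov function.** (1) $\Omega\subseteq G$ is an open domain, $0\in\Omega$. (2) $V_{\mathrm{loc}}:\bar\Omega\to[0,+\infty)$ is continuous, proper and positive definite, and for some continuous positive definite $W_{\mathrm{loc}}:\Omega\to[0,+\infty)$ one has $\inf_{u\in U}\partial^-V_{\mathrm{loc}}(x;f(x,u))\le-W_{\mathrm{loc}}(x)$ for all $x\in\Omega$. (3) $V_{\mathrm{loc}}$ is locally Lipschitz in $\Omega$. (4) $c>0$ is such that $\{x\in\bar\Omega:V_{\mathrm{loc}}(x)<c\}$ is an open domain whose closure is $\Omega_c=\{x\in\bar\Omega:V_{\mathrm{loc}}(x)\le c\}$; $\Omega_c+B_{C_3}\subseteq\Omega$ for some $C_3>0$; and $\partial\Omega_c=l_c=\{x\in\bar\Omega:V_{\mathrm{loc}}(x)=c\}$ is a connected piecewise regular hypersurface (for which only the following is required: a closed set in which those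 points are dense near which it is the zero set of a $C^1$ function with nonvanishing gradient). (5) $\lim_{\varepsilon\to0+}\sup\{\|x\|:x\in\bar\Omega,\ V_{\mathrm{loc}}(x)\le\varepsilon\}=0$. **(C) Running cost.** (1) $g:\bar G\times U\to[0,+\infty)$ is continuous. (2) For each $R>0$ there is $C_{5,R}>0$ with $|g(x,u)-g(x',u)|\le C_{5,R}\|x-x'\|$ for $x,x'\in\bar B_R\cap\bar G$, $u\in U$. (3) $g(x,u)>0$ for $x\in G\setminus\{0\}$, $u\in U$. (4) $\inf\{g(x,u):x\in G\setminus\operatorname{int}\Omega_c,\ u\in U\}>0$. **(D) Convexity.** For every $x\in\bar G$ the set $\{(f(x,u),y)\in\mathbb R^n\times\mathbb R:u\in U,\ y\ge g(x,u)\}$ is convex. Let $\mathcal D_0$ be the set of all $x_0\in G$ for which some $u(\cdot)\in\mathcal U$ gives $\lim_{t\to+\infty}\|x(t;x_0,u(\cdot))\|=0$, and let $T_{\Omega_c}(x_0,u(\cdot))=\inf\{T\ge0:x(T;x_0,u(\cdot))\in\Omega_c\}$, with $\inf\emptyset=+\infty$. Consider the exit-time problem $$V(x_0)=\inf_{u(\cdot)\in\mathcal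 U:\ T_{\Omega_c}(x_0,u(\cdot))<+\infty}\Big\{\int_0^{T_{\Omega_c}(x_0,u(\cdot))}g(x(t;x_0,u(\cdot)),u(t))\,dt+c\Big\}\qquad(\mathrm P)$$ and its free-terminal-time form $$\inf_{u(\cdot)\in\mathcal U,\ T\in[0,+\infty):\ x(T;x_0,u(\cdot))\in\Omega_c}\Big\{\int_0^Tg(x(t;x_0,u(\cdot)),u(t))\,dt+c\Big\}.\qquad(\mathrm P')$$ **Theorem.** Under (A)–(D), for every $x_0\in\mathcal D_0\setminus\Omega_c$ the infima in $(\mathrm P)$ and $(\mathrm P')$ are finite and equal, and both are attained: there exists an optimal control $u^*(\cdot)\in\mathcal U$ for $(\mathrm P)$, and there exists an optimal pair $(u(\cdot),T)$ for $(\mathrm P')$. Moreover, a control $u(\cdot)$ is optimal for $(\mathrm P)$ if and only if $(u(\cdot),T)$ is optimal for $(\mathrm P')$ for some $T\in[0,+\infty)$. -/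

import Mathlib

open MeasureTheory Filter Topology Set
open scoped ENNReal Pointwise

noncomputable section

namespace ExitTime

/-! ### General notions -/

/-- The restriction of `φ` to `S` is proper: preimages (in `S`) of compact sets of reals are
compact. -/
def IsProperOn {n : ℕ} (φ : EuclideanSpace ℝ (Fin n) → ℝ)
    (S : Set (EuclideanSpace ℝ (Fin n))) : Prop :=
  ∀ M : Set ℝ, IsCompact M → IsCompact (S ∩ φ ⁻¹' M)

/-- The restriction of `φ` to `S` (a set containing the origin) is positive definite. -/
def IsPosDefOn {n : ℕ} (φ : EuclideanSpace ℝ (Fin n) → ℝ)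
    (S : Set (EuclideanSpace ℝ (Fin n))) : Prop :=
  φ 0 = 0 ∧ ∀ x ∈ S, x ≠ 0 → 0 < φ x

/-- An open domain: an open connected (nonempty) set. -/
def IsOpenDomain {n : ℕ} (S : Set (EuclideanSpace ℝ (Fin n))) : Prop :=
  IsOpen S ∧ IsConnected S

/-- The lower Dini derivative (directional subderivate) of `φ` at `x` in the direction `v`,
`liminf (φ (x + r w) - φ x) / r` as `r → 0+` and `w → v`, with values in `[-∞, +∞]`. -/
def lowerDini {n : ℕ} (φ : EuclideanSpace ℝ (Fin n) → ℝ)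
    (x v : EuclideanSpace ℝ (Fin n)) : EReal :=
  liminf (fun p : ℝ × EuclideanSpace ℝ (Fin n) =>
    (((φ (x + p.1 • p.2) - φ x) / p.1 : ℝ) : EReal)) (𝓝[>] (0 : ℝ) ×ˢ 𝓝 v)

/-- `S` is a regular hypersurface near its point `x`: in a neighbourhood of `x` it is the zero
set of a continuously differentiable function with nonvanishing derivative. -/
def IsRegularPoint {n : ℕ} (S : Set (EuclideanSpace ℝ (Fin n)))
    (x : EuclideanSpace ℝ (Fin n)) : Prop :=
  x ∈ S ∧ ∃ W : Set (EuclideanSpace ℝ (Fin n)), IsOpen W ∧ x ∈ W ∧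
    ∃ φ : EuclideanSpace ℝ (Fin n) → ℝ, ContDiffOn ℝ 1 φ W ∧
      (∀ y ∈ W, fderiv ℝ φ y ≠ 0) ∧ S ∩ W = {y ∈ W | φ y = 0}

/-- A piecewise regular hypersurface: a closed set in which the points near which it is a regular
hypersurface are dense (so edges, corners and conical points between the regular pieces are
allowed). -/
def IsPiecewiseRegularHypersurface {n : ℕ} (S : Set (EuclideanSpace ℝ (Fin n))) : Prop :=
  IsClosed S ∧ S ⊆ closure {x | IsRegularPoint S x}

/-! ### Controls and trajectories -/

/-- The class of control functions: locally essentially bounded (Lebesgue measurable) functions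
on `[0, ∞)` with values in `U`.  Values at negative times are irrelevant. -/
def IsControl {m : ℕ} (U : Set (EuclideanSpace ℝ (Fin m)))
    (u : ℝ → EuclideanSpace ℝ (Fin m)) : Prop :=
  (∀ t, 0 ≤ t → u t ∈ U) ∧ ∀ T : ℝ, MemLp u ∞ (volume.restrict (Icc 0 T))

/-- `x` is, on the time interval `I` (which is `[0, T]`, `[0, T)` or `[0, ∞)` below), a
Carathéodory solution with values in `G₁` of `x' = f (x, u)`, `x 0 = x₀`: it satisfies the
integral equation. -/
def IsTrajectory {n m : ℕ} (G₁ : Set (EuclideanSpace ℝ (Fin n)))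
    (f : EuclideanSpace ℝ (Fin n) → EuclideanSpace ℝ (Fin m) → EuclideanSpace ℝ (Fin n))
    (u : ℝ → EuclideanSpace ℝ (Fin m)) (x₀ : EuclideanSpace ℝ (Fin n)) (I : Set ℝ)
    (x : ℝ → EuclideanSpace ℝ (Fin n)) : Prop :=
  ∀ t ∈ I, x t ∈ G₁ ∧ IntervalIntegrable (fun s => f (x s) (u s)) volume 0 t ∧
    x t = x₀ + ∫ s in (0 : ℝ)..t, f (x s) (u s)

/-- The global region of asymptotic null-controllability. -/
def nullControllable {n m : ℕ} (U : Set (EuclideanSpace ℝ (Fin m)))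
    (G G₁ : Set (EuclideanSpace ℝ (Fin n)))
    (f : EuclideanSpace ℝ (Fin n) → EuclideanSpace ℝ (Fin m) → EuclideanSpace ℝ (Fin n)) :
    Set (EuclideanSpace ℝ (Fin n)) :=
  {x₀ | x₀ ∈ G ∧ ∃ u, IsControl U u ∧ ∃ x, IsTrajectory G₁ f u x₀ (Ici 0) x ∧
    Tendsto (fun t => ‖x t‖) atTop (𝓝 0)}

/-! ### Standing assumptions -/

/-- The assumptions on the control system. -/
structure SystemAssumption {n m : ℕ} (U : Set (EuclideanSpace ℝ (Fin m)))
    (G G₁ : Set (EuclideanSpace ℝ (Fin n)))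
    (f : EuclideanSpace ℝ (Fin n) → EuclideanSpace ℝ (Fin m) → EuclideanSpace ℝ (Fin n)) :
    Prop where
  isCompact_U : IsCompact U
  domain_G : IsOpenDomain G
  domain_G₁ : IsOpenDomain G₁
  closure_subset : closure G ⊆ G₁
  zero_mem : (0 : EuclideanSpace ℝ (Fin n)) ∈ G
  continuousOn_f : ContinuousOn (Function.uncurry f) (G₁ ×ˢ U)
  /-- Strong invariance of `G`.  The case of the interval `[0, ∞)` follows from that of all
  intervals `[0, T)`; since `G` is open, `x t ∈ G` excludes `x t ∈ frontier G`. -/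
  invariant : ∀ u, IsControl U u → ∀ x₀ ∈ G, ∀ T : ℝ, 0 < T → ∀ x,
    IsTrajectory G₁ f u x₀ (Ico 0 T) x → ∀ t ∈ Ico (0 : ℝ) T, x t ∈ G
  lipschitz_f : ∀ R : ℝ, 0 < R → ∃ C : ℝ, 0 < C ∧
    ∀ x ∈ Metric.closedBall 0 R ∩ closure G, ∀ x' ∈ Metric.closedBall 0 R ∩ closure G,
      ∀ u ∈ U, ‖f x u - f x' u‖ ≤ C * ‖x - x'‖
  growth : ∃ Y : EuclideanSpace ℝ (Fin n) → ℝ, ContDiffOn ℝ 1 Y G₁ ∧ (∀ x ∈ G₁, 0 ≤ Y x) ∧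
    IsProperOn Y G₁ ∧ ∃ C : ℝ, 0 < C ∧ ∀ x ∈ G₁, ∀ u ∈ U, fderiv ℝ Y x (f x u) ≤ C * Y x

/-- The sublevel set `Ω_c = {x ∈ closure Ω | V x ≤ c}`. -/
def sublevel {n : ℕ} (Ω : Set (EuclideanSpace ℝ (Fin n))) (V : EuclideanSpace ℝ (Fin n) → ℝ)
    (c : ℝ) : Set (EuclideanSpace ℝ (Fin n)) :=
  {x | x ∈ closure Ω ∧ V x ≤ c}

/-- The level set `l_c = {x ∈ closure Ω | V x = c}`. -/
def level {n : ℕ} (Ω : Set (EuclideanSpace ℝ (Fin n))) (V : EuclideanSpace ℝ (Fin n) → ℝ)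
    (c : ℝ) : Set (EuclideanSpace ℝ (Fin n)) :=
  {x | x ∈ closure Ω ∧ V x = c}

/-- The assumptions on the local control Lyapunov function `V` (used on `closure Ω` only) and on
the level `c`. -/
structure LocalCLFAssumption {n m : ℕ} (U : Set (EuclideanSpace ℝ (Fin m)))
    (G : Set (EuclideanSpace ℝ (Fin n)))
    (f : EuclideanSpace ℝ (Fin n) → EuclideanSpace ℝ (Fin m) → EuclideanSpace ℝ (Fin n))
    (Ω : Set (EuclideanSpace ℝ (Fin n))) (V : EuclideanSpace ℝ (Fin n) → ℝ) (c : ℝ) :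
    Prop where
  subset_G : Ω ⊆ G
  domain_Ω : IsOpenDomain Ω
  zero_mem : (0 : EuclideanSpace ℝ (Fin n)) ∈ Ω
  continuousOn_V : ContinuousOn V (closure Ω)
  nonneg_V : ∀ x ∈ closure Ω, 0 ≤ V x
  proper_V : IsProperOn V (closure Ω)
  posDef_V : IsPosDefOn V (closure Ω)
  decrease : ∃ W : EuclideanSpace ℝ (Fin n) → ℝ, ContinuousOn W Ω ∧ IsPosDefOn W Ω ∧
    ∀ x ∈ Ω, ⨅ u ∈ U, lowerDini V x (f x u) ≤ ((-W x : ℝ) : EReal)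
  locallyLipschitz_V : LocallyLipschitzOn Ω V
  c_pos : 0 < c
  domain_strict : IsOpenDomain {x | x ∈ closure Ω ∧ V x < c}
  closure_strict : closure {x | x ∈ closure Ω ∧ V x < c} = sublevel Ω V c
  margin : ∃ C : ℝ, 0 < C ∧ sublevel Ω V c + Metric.ball 0 C ⊆ Ω
  frontier_sublevel : frontier (sublevel Ω V c) = level Ω V c
  connected_level : IsConnected (level Ω V c)
  hypersurface_level : IsPiecewiseRegularHypersurface (level Ω V c)
  shrink : Tendsto (fun ε : ℝ => sSup ((fun x => ‖x‖) '' {x | x ∈ closure Ω ∧ V x ≤ ε}))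
    (𝓝[>] 0) (𝓝 0)

/-- The assumptions on the running cost `g`; `K` is the target set.  The last one says that
the infimum of `g` over `(G \ interior K) × U` is positive. -/
structure CostAssumption {n m : ℕ} (U : Set (EuclideanSpace ℝ (Fin m)))
    (G : Set (EuclideanSpace ℝ (Fin n)))
    (g : EuclideanSpace ℝ (Fin n) → EuclideanSpace ℝ (Fin m) → ℝ)
    (K : Set (EuclideanSpace ℝ (Fin n))) : Prop where
  continuousOn_g : ContinuousOn (Function.uncurry g) (closure G ×ˢ U)
  nonneg_g : ∀ x ∈ closure G, ∀ u ∈ U, 0 ≤ g x u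
  lipschitz_g : ∀ R : ℝ, 0 < R → ∃ C : ℝ, 0 < C ∧
    ∀ x ∈ Metric.closedBall 0 R ∩ closure G, ∀ x' ∈ Metric.closedBall 0 R ∩ closure G,
      ∀ u ∈ U, |g x u - g x' u| ≤ C * ‖x - x'‖
  pos_g : ∀ x ∈ G, x ≠ 0 → ∀ u ∈ U, 0 < g x u
  inf_pos : ∃ C : ℝ, 0 < C ∧ ∀ x ∈ G \ interior K, ∀ u ∈ U, C ≤ g x u

/-- Convexity of the extended velocity sets. -/
def ConvexityAssumption {n m : ℕ} (U : Set (EuclideanSpace ℝ (Fin m)))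
    (G : Set (EuclideanSpace ℝ (Fin n)))
    (f : EuclideanSpace ℝ (Fin n) → EuclideanSpace ℝ (Fin m) → EuclideanSpace ℝ (Fin n))
    (g : EuclideanSpace ℝ (Fin n) → EuclideanSpace ℝ (Fin m) → ℝ) : Prop :=
  ∀ x ∈ closure G,
    Convex ℝ {p : EuclideanSpace ℝ (Fin n) × ℝ | ∃ u ∈ U, p.1 = f x u ∧ g x u ≤ p.2}

/-! ### The exit-time problem -/

/-- The minimum time of reaching `K` from `x₀` under the control `u` (`⊤` if `K` is never
reached). -/
def exitTime {n m : ℕ} (G₁ : Set (EuclideanSpace ℝ (Fin n)))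
    (f : EuclideanSpace ℝ (Fin n) → EuclideanSpace ℝ (Fin m) → EuclideanSpace ℝ (Fin n))
    (K : Set (EuclideanSpace ℝ (Fin n))) (x₀ : EuclideanSpace ℝ (Fin n))
    (u : ℝ → EuclideanSpace ℝ (Fin m)) : ℝ≥0∞ :=
  sInf {τ | ∃ T : ℝ, 0 ≤ T ∧ τ = ENNReal.ofReal T ∧
    ∃ x, IsTrajectory G₁ f u x₀ (Icc 0 T) x ∧ x T ∈ K}

/-- Running cost of the pair `(x, u)` over `[0, T]` plus the constant terminal cost `c`. -/
def cost {n m : ℕ} (g : EuclideanSpace ℝ (Fin n) → EuclideanSpace ℝ (Fin m) → ℝ) (c : ℝ)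
    (x : ℝ → EuclideanSpace ℝ (Fin n)) (u : ℝ → EuclideanSpace ℝ (Fin m)) (T : ℝ) : ℝ≥0∞ :=
  (∫⁻ t in Icc 0 T, ENNReal.ofReal (g (x t) (u t))) + ENNReal.ofReal c

/-- `J` is the cost of the control `u` in the problem with exit at the first time of reaching `K`;
in particular this time is finite. -/
def IsExitCost {n m : ℕ} (U : Set (EuclideanSpace ℝ (Fin m)))
    (G₁ : Set (EuclideanSpace ℝ (Fin n)))
    (f : EuclideanSpace ℝ (Fin n) → EuclideanSpace ℝ (Fin m) → EuclideanSpace ℝ (Fin n))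
    (g : EuclideanSpace ℝ (Fin n) → EuclideanSpace ℝ (Fin m) → ℝ) (c : ℝ)
    (K : Set (EuclideanSpace ℝ (Fin n))) (x₀ : EuclideanSpace ℝ (Fin n))
    (u : ℝ → EuclideanSpace ℝ (Fin m)) (J : ℝ≥0∞) : Prop :=
  IsControl U u ∧ exitTime G₁ f K x₀ u < ∞ ∧
    ∃ x, IsTrajectory G₁ f u x₀ (Icc 0 (exitTime G₁ f K x₀ u).toReal) x ∧
      J = cost g c x u (exitTime G₁ f K x₀ u).toReal

/-- `J` is the cost of the pair `(u, T)` in the problem with free terminal time `T` and terminal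
constraint `x T ∈ K`. -/
def IsFreeTimeCost {n m : ℕ} (U : Set (EuclideanSpace ℝ (Fin m)))
    (G₁ : Set (EuclideanSpace ℝ (Fin n)))
    (f : EuclideanSpace ℝ (Fin n) → EuclideanSpace ℝ (Fin m) → EuclideanSpace ℝ (Fin n))
    (g : EuclideanSpace ℝ (Fin n) → EuclideanSpace ℝ (Fin m) → ℝ) (c : ℝ)
    (K : Set (EuclideanSpace ℝ (Fin n))) (x₀ : EuclideanSpace ℝ (Fin n))
    (u : ℝ → EuclideanSpace ℝ (Fin m)) (T : ℝ) (J : ℝ≥0∞) : Prop :=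
  IsControl U u ∧ 0 ≤ T ∧ ∃ x, IsTrajectory G₁ f u x₀ (Icc 0 T) x ∧ x T ∈ K ∧ J = cost g c x u T

/-- The value function of the first-exit problem (`⊤` if `K` cannot be reached). -/
def exitValue {n m : ℕ} (U : Set (EuclideanSpace ℝ (Fin m)))
    (G₁ : Set (EuclideanSpace ℝ (Fin n)))
    (f : EuclideanSpace ℝ (Fin n) → EuclideanSpace ℝ (Fin m) → EuclideanSpace ℝ (Fin n))
    (g : EuclideanSpace ℝ (Fin n) → EuclideanSpace ℝ (Fin m) → ℝ) (c : ℝ)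
    (K : Set (EuclideanSpace ℝ (Fin n))) (x₀ : EuclideanSpace ℝ (Fin n)) : ℝ≥0∞ :=
  sInf {J | ∃ u, IsExitCost U G₁ f g c K x₀ u J}

/-- The value function of the free-terminal-time problem. -/
def freeTimeValue {n m : ℕ} (U : Set (EuclideanSpace ℝ (Fin m)))
    (G₁ : Set (EuclideanSpace ℝ (Fin n)))
    (f : EuclideanSpace ℝ (Fin n) → EuclideanSpace ℝ (Fin m) → EuclideanSpace ℝ (Fin n))
    (g : EuclideanSpace ℝ (Fin n) → EuclideanSpace ℝ (Fin m) → ℝ) (c : ℝ)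
    (K : Set (EuclideanSpace ℝ (Fin n))) (x₀ : EuclideanSpace ℝ (Fin n)) : ℝ≥0∞ :=
  sInf {J | ∃ u T, IsFreeTimeCost U G₁ f g c K x₀ u T J}

/-- `u` is an optimal control in the first-exit problem. -/
def IsOptimalControl {n m : ℕ} (U : Set (EuclideanSpace ℝ (Fin m)))
    (G₁ : Set (EuclideanSpace ℝ (Fin n)))
    (f : EuclideanSpace ℝ (Fin n) → EuclideanSpace ℝ (Fin m) → EuclideanSpace ℝ (Fin n))
    (g : EuclideanSpace ℝ (Fin n) → EuclideanSpace ℝ (Fin m) → ℝ) (c : ℝ)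
    (K : Set (EuclideanSpace ℝ (Fin n))) (x₀ : EuclideanSpace ℝ (Fin n))
    (u : ℝ → EuclideanSpace ℝ (Fin m)) : Prop :=
  IsExitCost U G₁ f g c K x₀ u (exitValue U G₁ f g c K x₀)

/-- `(u, T)` is an optimal pair in the free-terminal-time problem. -/
def IsOptimalPair {n m : ℕ} (U : Set (EuclideanSpace ℝ (Fin m)))
    (G₁ : Set (EuclideanSpace ℝ (Fin n)))
    (f : EuclideanSpace ℝ (Fin n) → EuclideanSpace ℝ (Fin m) → EuclideanSpace ℝ (Fin n))
    (g : EuclideanSpace ℝ (Fin n) → EuclideanSpace ℝ (Fin m) → ℝ) (c : ℝ)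
    (K : Set (EuclideanSpace ℝ (Fin n))) (x₀ : EuclideanSpace ℝ (Fin n))
    (u : ℝ → EuclideanSpace ℝ (Fin m)) (T : ℝ) : Prop :=
  IsFreeTimeCost U G₁ f g c K x₀ u T (freeTimeValue U G₁ f g c K x₀)

end ExitTime

end

/-!
This is the direct method of the calculus of variations, in the form due to Filippov and Roxin. Up
to a fixed horizon all trajectories from `x₀` stay in one compact set, because
`Y (x t) ≤ Y x₀ * exp (C₂ * t)`. Together with the accumulated cost they are Lipschitz solutions of
the differential inclusion whose right-hand side is the extended velocity set
`{(f x u, r) | u ∈ U, g x u ≤ r}`. This set is closed, convex and upper semicontinuous in `x`, so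
the pairs of a time and an attainable point form a compact set, and on the part over the target the
accumulated cost has a minimum; a measurable selection turns a minimizing solution back into a
control of no greater cost. Since `g` is bounded below by a positive constant off the target, late
exits are expensive and the horizon may be fixed in advance.

Stopping a trajectory when it first meets the closed target does not increase its cost, which is
why the problems with exit time and with free terminal time have the same optimal controls.
-/

namespace ExitTime

/-! ### Measurable selection -/

section Selection

variable {α X : Type*} [MeasurableSpace α] {S : Set X}

theorem measurableSet_exists_zero [PseudoMetricSpace X] (hS : IsCompact S) {h : α → X → ℝ}
    (hm : ∀ u ∈ S, Measurable fun a => h a u) (hc : ∀ a, ContinuousOn (h a) S) :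
    MeasurableSet {a | ∃ u ∈ S, h a u = 0} := by
  obtain ⟨D, hDS, hD, hSD⟩ : ∃ D ⊆ S, D.Countable ∧ S ⊆ closure D :=
    hS.isSeparable.exists_countable_dense_subset
  have zero_iff (a : α) :
      (∃ u ∈ S, h a u = 0) ↔ ∀ k : ℕ, ∃ d ∈ D, |h a d| < 1 / ((k : ℝ) + 1) := by
    constructor
    · rintro ⟨u, hu, hz⟩ k
      have hk : |h a u| < 1 / ((k : ℝ) + 1) := by rw [hz, abs_zero]; positivity
      have near : ∀ᶠ d in 𝓝[D] u, |h a d| < 1 / ((k : ℝ) + 1) :=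
        ((hc a u hu).mono hDS).abs.eventually (gt_mem_nhds hk)
      have : (𝓝[D] u).NeBot := mem_closure_iff_nhdsWithin_neBot.1 (hSD hu)
      obtain ⟨d, hd, hdD⟩ := (near.and self_mem_nhdsWithin).exists
      exact ⟨d, hdD, hd⟩
    · intro H
      obtain ⟨d, hd, -⟩ := H 0
      obtain ⟨u, hu, hmin⟩ := hS.exists_isMinOn ⟨d, hDS hd⟩ (hc a).abs
      refine ⟨u, hu, abs_eq_zero.1 (le_antisymm (le_of_forall_pos_lt_add fun ε hε => ?_)
        (abs_nonneg _))⟩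
      obtain ⟨k, hk⟩ := exists_nat_one_div_lt hε
      obtain ⟨d, hd, hlt⟩ := H k
      have hud : |h a u| ≤ |h a d| := hmin (hDS hd)
      linarith
  simp only [zero_iff, ofPred_forall]
  refine MeasurableSet.iInter fun k => ?_
  convert MeasurableSet.biUnion hD fun d hd =>
    measurableSet_lt (hm d (hDS hd)).abs (measurable_const (a := 1 / ((k : ℝ) + 1))) using 1
  simp only [← exists_prop, ofPred_exists]

theorem exists_measurable_zero_of_isCompact_real {Q : Set ℝ} (hQ : IsCompact Q) {h : α → Q → ℝ}
    (hm : ∀ q, Measurable fun a => h a q) (hc : ∀ a, Continuous (h a))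
    (hz : ∀ a, ∃ q, h a q = 0) : ∃ σ : α → Q, Measurable σ ∧ ∀ a, h a (σ a) = 0 := by
  have : CompactSpace Q := isCompact_iff_compactSpace.1 hQ
  have least (a : α) : ∃ q : Q, IsLeast {q | h a q = 0} q :=
    (isClosed_eq (hc a) continuous_const).isCompact.exists_isLeast (hz a)
  choose σ hσ using least
  have measurable_coe : Measurable fun a => (σ a : ℝ) := by
    refine measurable_of_Iic fun r => ?_
    convert measurableSet_exists_zero (S := {q : Q | (q : ℝ) ≤ r})
      (isClosed_le continuous_subtype_val continuous_const).isCompact (fun q _ => hm q)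
      (fun a => (hc a).continuousOn) using 1
    ext a
    exact ⟨fun ha => ⟨σ a, ha, (hσ a).1⟩,
      fun ⟨q, hq, hq0⟩ => (Subtype.coe_le_coe.2 ((hσ a).2 hq0)).trans hq⟩
  exact ⟨σ, measurable_coe.subtype_mk, fun a => (hσ a).1⟩

theorem exists_continuous_cantorSet_range_eq [MetricSpace X] (hS : IsCompact S)
    (hne : S.Nonempty) : ∃ ψ : cantorSet → X, Continuous ψ ∧ range ψ = S := by
  have : CompactSpace S := isCompact_iff_compactSpace.1 hS
  have : Nonempty S := hne.to_subtype
  obtain ⟨φ, hφ, hsurj⟩ := exists_nat_bool_continuous_surjective_of_compact S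
  refine ⟨fun t => φ (cantorSetHomeomorphNatToBool t), by fun_prop, ?_⟩
  rw [show (fun t => (φ (cantorSetHomeomorphNatToBool t) : X)) =
    (Subtype.val ∘ φ) ∘ cantorSetHomeomorphNatToBool from rfl,
    cantorSetHomeomorphNatToBool.surjective.range_comp, hsurj.range_comp, Subtype.range_val]

-- A compact metric space is a continuous image of the Cantor set, and in a compact set of reals the
-- least zero is a measurable choice.
theorem exists_measurable_zero [MetricSpace X] [MeasurableSpace X] [BorelSpace X]
    (hS : IsCompact S) {h : α → X → ℝ} (hm : ∀ u ∈ S, Measurable fun a => h a u)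
    (hc : ∀ a, ContinuousOn (h a) S) (hz : ∀ a, ∃ u ∈ S, h a u = 0) :
    ∃ σ : α → X, Measurable σ ∧ ∀ a, σ a ∈ S ∧ h a (σ a) = 0 := by
  rcases S.eq_empty_or_nonempty with rfl | hne
  · have : IsEmpty α := ⟨fun a => (hz a).choose_spec.1⟩
    exact ⟨isEmptyElim, measurable_of_empty _, isEmptyElim⟩
  obtain ⟨ψ, hψ, rfl⟩ := exists_continuous_cantorSet_range_eq hS hne
  obtain ⟨τ, hτ, hτz⟩ := exists_measurable_zero_of_isCompact_real isCompact_cantorSet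
    (h := fun a q => h a (ψ q)) (fun q => hm _ (mem_range_self q))
    (fun a => (hc a).comp_continuous hψ mem_range_self) (fun a => by simpa using hz a)
  exact ⟨ψ ∘ τ, hψ.measurable.comp hτ, fun a => ⟨mem_range_self _, hτz a⟩⟩

theorem exists_measurable_ae_zero [MetricSpace X] [MeasurableSpace X] [BorelSpace X]
    {μ : Measure α} (hS : IsCompact S) (hne : S.Nonempty) {h : α → X → ℝ}
    (hm : ∀ u ∈ S, Measurable fun a => h a u) (hc : ∀ a, ContinuousOn (h a) S)
    (hz : ∀ᵐ a ∂μ, ∃ u ∈ S, h a u = 0) :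
    ∃ σ : α → X, Measurable σ ∧ (∀ a, σ a ∈ S) ∧ ∀ᵐ a ∂μ, h a (σ a) = 0 := by
  set N : Set α := {a | ∃ u ∈ S, h a u = 0}
  have hN : MeasurableSet N := measurableSet_exists_zero hS hm hc
  obtain ⟨σ, hσ, hσz⟩ := exists_measurable_zero hS (h := fun a u => N.indicator (h · u) a)
    (fun u hu => (hm u hu).indicator hN)
    (fun a => by by_cases ha : a ∈ N <;> simp [ha, hc a, continuousOn_const])
    (fun a => by
      by_cases ha : a ∈ N
      · obtain ⟨u, hu, hu0⟩ := id ha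
        exact ⟨u, hu, by rw [indicator_of_mem ha, hu0]⟩
      · exact ⟨hne.some, hne.some_mem, indicator_of_notMem ha _⟩)
  refine ⟨σ, hσ, fun a => (hσz a).1, ?_⟩
  filter_upwards [hz] with a ha
  simpa only [indicator_of_mem (show a ∈ N from ha)] using (hσz a).2

end Selection

/-! ### Averages, Lipschitz curves and Gronwall's inequality -/

section Calculus

variable {X : Type*} [NormedAddCommGroup X]

theorem intervalIntegrable_of_norm_le {v : ℝ → X} {L : ℝ}
    (hv : AEStronglyMeasurable v) (hL : ∀ t, ‖v t‖ ≤ L) (a b : ℝ) :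
    IntervalIntegrable v volume a b :=
  (intervalIntegrable_const (c := L)).mono_fun hv.restrict
    (ae_of_all _ fun t => (hL t).trans (le_abs_self L))

variable [NormedSpace ℝ X]

theorem inv_smul_integral_mem [CompleteSpace X] {Q : Set X} (hQ : Convex ℝ Q) (hQc : IsClosed Q)
    {a b : ℝ} (hab : a < b) {v : ℝ → X} (hv : IntervalIntegrable v volume a b)
    (hvQ : ∀ᵐ s ∂volume.restrict (Ioc a b), v s ∈ Q) : (b - a)⁻¹ • ∫ s in a..b, v s ∈ Q := by
  rw [← interval_average_eq, uIoc_of_le hab.le]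
  exact hQ.set_average_mem hQc (by simp [hab]) (by simp) hvQ
    ((intervalIntegrable_iff_integrableOn_Ioc_of_le hab.le).1 hv)

theorem lipschitzWith_integral {v : ℝ → X} {L : NNReal} (hv : AEStronglyMeasurable v)
    (hL : ∀ t, ‖v t‖ ≤ L) (a : ℝ) : LipschitzWith L fun t => ∫ s in a..t, v s := by
  have hint := intervalIntegrable_of_norm_le hv hL
  refine LipschitzWith.of_dist_le_mul fun s t => ?_
  rw [dist_eq_norm, intervalIntegral.integral_interval_sub_left (hint _ _) (hint _ _),
    Real.dist_eq]
  exact intervalIntegral.norm_integral_le_of_norm_le_const fun r _ => hL r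

theorem exists_lipschitzWith_eq_integral [CompleteSpace X] {v : ℝ → X} {T : ℝ} {L : NNReal}
    (hv : AEStronglyMeasurable v (volume.restrict (Ioc 0 T))) (hL : ∀ t ∈ Ioc 0 T, ‖v t‖ ≤ L)
    (a : X) : ∃ p : ℝ → X, LipschitzWith L p ∧ (∀ t ∈ Icc 0 T, p t = a + ∫ s in 0..t, v s) ∧
      ∀ᵐ t ∂volume.restrict (Ioc 0 T), deriv p t = v t := by
  set w := (Ioc 0 T).indicator v with hw
  have hwm : AEStronglyMeasurable w := (aestronglyMeasurable_indicator_iff measurableSet_Ioc).2 hv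
  have hwL (t : ℝ) : ‖w t‖ ≤ L := by
    by_cases ht : t ∈ Ioc 0 T
    · simpa [hw, ht] using hL t ht
    · simp [hw, ht]
  refine ⟨fun t => a + ∫ s in 0..t, w s, ?_, fun t ht => ?_, ?_⟩
  · simpa using (LipschitzWith.const a).add (lipschitzWith_integral hwm hwL 0)
  · refine congrArg (a + ·) (intervalIntegral.integral_congr_ae (ae_of_all _ fun s hs => ?_))
    rw [uIoc_of_le ht.1] at hs
    exact indicator_of_mem (Ioc_subset_Ioc_right ht.2 hs) v
  · filter_upwards [ae_restrict_mem measurableSet_Ioc, ae_restrict_of_ae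
      (intervalIntegrable_of_norm_le hwm hwL 0 T).ae_hasDerivAt_integral] with t ht hder
    have htT : t ∈ uIcc 0 T := by
      rw [uIcc_of_le (ht.1.le.trans ht.2)]
      exact Ioc_subset_Icc_self ht
    rw [((hder htT 0 left_mem_uIcc).const_add a).deriv, hw, indicator_of_mem ht]

theorem intervalIntegrable_deriv_of_lipschitzWith [FiniteDimensional ℝ X] {L : NNReal}
    {p : ℝ → X} (hp : LipschitzWith L p) (a b : ℝ) : IntervalIntegrable (deriv p) volume a b := by
  have : CompleteSpace X := FiniteDimensional.complete ℝ X
  borelize X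
  exact intervalIntegrable_of_norm_le (stronglyMeasurable_deriv p).aestronglyMeasurable
    (fun t => norm_deriv_le_of_lipschitz hp) a b

theorem integral_deriv_of_lipschitzWith [FiniteDimensional ℝ X] {L : NNReal}
    {p : ℝ → X} (hp : LipschitzWith L p) (a b : ℝ) : ∫ t in a..b, deriv p t = p b - p a := by
  have : CompleteSpace X := FiniteDimensional.complete ℝ X
  borelize X
  have hint := intervalIntegrable_deriv_of_lipschitzWith hp
  have hI := lipschitzWith_integral (stronglyMeasurable_deriv p).aestronglyMeasurable
    (fun t => norm_deriv_le_of_lipschitz hp) a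
  have hac := ((hp.sub hI).lipschitzOnWith (s := uIcc a b)).absolutelyContinuousOnInterval
  have hder : ∀ᵐ t, t ∈ uIcc a b → HasDerivAt (fun t => p t - ∫ s in a..t, deriv p s) 0 t := by
    filter_upwards [(hint a b).ae_hasDerivAt_integral, hp.ae_differentiableAt (μ := volume)]
      with t hIt hpt ht
    exact (hpt.hasDerivAt.sub (hIt ht a left_mem_uIcc)).congr_deriv (sub_self _)
  obtain ⟨C, hC⟩ := hac.const_of_ae_hasDerivAt_zero hder
  have ha : p a - 0 = C := by simpa using hC a left_mem_uIcc
  have hb : p b - ∫ s in a..b, deriv p s = C := hC b right_mem_uIcc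
  rw [← sub_zero (p a), ha, ← hb, sub_sub_cancel]

theorem le_mul_exp_of_ae_deriv_le {φ : ℝ → ℝ} {a b C : ℝ} (hab : a ≤ b)
    (hφ : AbsolutelyContinuousOnInterval φ a b)
    (hC : ∀ᵐ t ∂volume.restrict (Ioo a b), deriv φ t ≤ C * φ t) :
    φ b ≤ φ a * Real.exp (C * (b - a)) := by
  set ψ : ℝ → ℝ := fun t => φ t * Real.exp (-(C * (t - a))) with hψ
  have hexp (t : ℝ) : HasDerivAt (fun t => Real.exp (-(C * (t - a))))
      (Real.exp (-(C * (t - a))) * -C) t := by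
    simpa using ((((hasDerivAt_id t).sub_const a).const_mul C).neg).exp
  have hψac : AbsolutelyContinuousOnInterval ψ a b :=
    hφ.mul (ContDiffOn.absolutelyContinuousOnInterval (by fun_prop))
  have hψ' : ∀ᵐ t ∂volume.restrict (Ioc a b), deriv ψ t ≤ 0 := by
    rw [← Measure.restrict_congr_set Ioo_ae_eq_Ioc]
    filter_upwards [hC, ae_restrict_mem measurableSet_Ioo,
      ae_restrict_of_ae hφ.ae_differentiableAt] with t ht htm hd
    rw [uIcc_of_le hab] at hd
    have hψt : deriv ψ t = _ :=
      ((hd (Ioo_subset_Icc_self htm)).hasDerivAt.mul (hexp t)).deriv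
    rw [hψt]
    have hpos := Real.exp_pos (-(C * (t - a)))
    nlinarith
  have hle : ψ b ≤ ψ a := by
    rw [← sub_nonpos, ← hψac.integral_deriv_eq_sub, intervalIntegral.integral_of_le hab]
    exact integral_nonpos_of_ae hψ'
  simpa [hψ, Real.exp_neg, ← div_eq_mul_inv, div_le_iff₀ (Real.exp_pos _)] using hle

end Calculus

/-! ### Differential inclusions -/

section LipschitzFamily

variable {ι X : Type*} [PseudoMetricSpace X] {P : ι → ℝ → X} {p : ℝ → X} {L : NNReal}

theorem lipschitzWith_of_tendsto {l : Filter ι} [l.NeBot] (hP : ∀ k, LipschitzWith L (P k))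
    (hp : ∀ t, Tendsto (fun k => P k t) l (𝓝 (p t))) : LipschitzWith L p :=
  LipschitzWith.of_dist_le_mul fun s t =>
    le_of_tendsto ((hp s).dist (hp t)) (.of_forall fun k => (hP k).dist_le_mul s t)

theorem tendsto_apply_of_lipschitzWith {l : Filter ι} (hP : ∀ k, LipschitzWith L (P k))
    {s : ι → ℝ} {t : ℝ} {y : X} (hy : Tendsto (fun k => P k t) l (𝓝 y))
    (hs : Tendsto s l (𝓝 t)) : Tendsto (fun k => P k (s k)) l (𝓝 y) := by
  have hdist : Tendsto (fun k => dist (P k t) (P k (s k))) l (𝓝 0) := by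
    refine squeeze_zero (fun k => dist_nonneg) (fun k => (hP k).dist_le_mul t (s k)) ?_
    simpa [dist_comm] using (tendsto_iff_dist_tendsto_zero.1 hs).const_mul (L : ℝ)
  exact (tendsto_iff_of_dist hdist).1 hy

theorem exists_tendsto_of_lipschitzWith [ProperSpace X] (l : Ultrafilter ι) {a : X}
    (hP : ∀ k, LipschitzWith L (P k)) (h0 : ∀ k, P k 0 = a) :
    ∃ p : ℝ → X, ∀ t, Tendsto (fun k => P k t) l (𝓝 (p t)) := by
  suffices ∀ t, ∃ q, Tendsto (fun k => P k t) l (𝓝 q) from Classical.skolem.1 this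
  intro t
  have hmem (k : ι) : P k t ∈ Metric.closedBall a (L * dist t 0) := by
    simpa [h0 k] using (hP k).dist_le_mul t 0
  obtain ⟨q, -, hq⟩ := (isCompact_closedBall a (L * dist t 0)).ultrafilter_le_nhds'
    (l.map fun k => P k t) (Filter.univ_mem' (f := (l : Filter ι)) hmem)
  exact ⟨q, hq⟩

end LipschitzFamily

section DifferentialInclusion

/-- Upper semicontinuity on `S` of a set-valued map in the `ε`-sense. For unbounded values, such as
epigraphs, it is weaker than upper hemicontinuity. -/
def IsHausdorffUSCOn {Y X : Type*} [TopologicalSpace Y] [PseudoEMetricSpace X] (F : Y → Set X)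
    (S : Set Y) : Prop :=
  ∀ y ∈ S, ∀ ε > 0, ∀ᶠ y' in 𝓝[S] y, F y' ⊆ Metric.cthickening ε (F y)

theorem IsHausdorffUSCOn.comp {Y Y' X : Type*} [TopologicalSpace Y] [TopologicalSpace Y']
    [PseudoEMetricSpace X] {F : Y → Set X} {S : Set Y} {φ : Y' → Y} {S' : Set Y'}
    (hF : IsHausdorffUSCOn F S) (hφ : ContinuousOn φ S') (hmaps : MapsTo φ S' S) :
    IsHausdorffUSCOn (F ∘ φ) S' := fun y hy ε hε =>
  ((hφ y hy).tendsto_nhdsWithin hmaps).eventually (hF (φ y) (hmaps hy) ε hε)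

variable {X : Type*} [NormedAddCommGroup X] [NormedSpace ℝ X]

/-- `p` is an `L`-Lipschitz solution of the differential inclusion `p' ∈ F p`, `p 0 = a`, on
`[0, T]` with state constraint `S`. Solutions are defined on the whole line, so that solutions on
intervals of different lengths have pointwise limits; only their values on `[0, T]` matter. -/
structure IsInclusionSolution (F : X → Set X) (S : Set X) (L : NNReal) (a : X) (T : ℝ)
    (p : ℝ → X) : Prop where
  nonneg : 0 ≤ T
  lipschitzWith : LipschitzWith L p
  apply_zero : p 0 = a
  mem : ∀ t ∈ Icc 0 T, p t ∈ S
  deriv_mem : ∀ᵐ t ∂volume.restrict (Ioc 0 T), deriv p t ∈ F (p t)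

/-- The pairs `(T, q)` with `T ≤ M` such that a solution of the differential inclusion on `[0, T]`
ends at `q`. -/
def attainableSet (F : X → Set X) (S : Set X) (L : NNReal) (a : X) (M : ℝ) : Set (ℝ × X) :=
  {q | q.1 ≤ M ∧ ∃ p, IsInclusionSolution F S L a q.1 p ∧ p q.1 = q.2}

variable {ι : Type*} {l : Filter ι} {F : X → Set X} {S : Set X} {L : NNReal} {a : X}
  {T : ι → ℝ} {P : ι → ℝ → X} {τ t : ℝ} {p : ℝ → X}

theorem eventually_deriv_mem_cthickening (hF : IsHausdorffUSCOn F S)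
    (hP : ∀ k, IsInclusionSolution F S L a (T k) (P k)) (hT : Tendsto T l (𝓝 τ)) {y : X}
    (hy : Tendsto (fun k => P k t) l (𝓝 y)) (hyS : y ∈ S) (ht : t ∈ Ico 0 τ) {ε : ℝ}
    (hε : 0 < ε) : ∀ᶠ s in 𝓝[>] t, ∀ᶠ k in l, ∀ᵐ r ∂volume.restrict (Ioc t s),
      deriv (P k) r ∈ Metric.cthickening ε (F y) := by
  obtain ⟨ρ, hρ, hFρ⟩ := Metric.mem_nhdsWithin_iff.1 (hF y hyS ε hε)
  have hsmall : ∀ᶠ s in 𝓝[>] t, L * (s - t) < ρ / 2 := by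
    have : Tendsto (fun s => L * (s - t)) (𝓝 t) (𝓝 (L * (t - t))) :=
      Continuous.tendsto (by fun_prop) t
    exact (this.mono_left nhdsWithin_le_nhds).eventually (gt_mem_nhds (by simpa using hρ))
  filter_upwards [hsmall, Ioo_mem_nhdsGT ht.2] with s hs hsτ
  filter_upwards [hT.eventually (lt_mem_nhds hsτ.2),
    hy.eventually (Metric.ball_mem_nhds _ (half_pos hρ))] with k hsT hk
  filter_upwards [ae_restrict_of_ae_restrict_of_subset
    (Ioc_subset_Ioc ht.1 hsT.le) (hP k).deriv_mem, ae_restrict_mem measurableSet_Ioc] with r hr hrs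
  refine hFρ ⟨?_, (hP k).mem r ⟨ht.1.trans hrs.1.le, hrs.2.trans hsT.le⟩⟩ hr
  calc dist (P k r) y ≤ dist (P k r) (P k t) + dist (P k t) y := dist_triangle _ _ _
    _ < ρ / 2 + ρ / 2 := by
      refine add_lt_add (lt_of_le_of_lt ((hP k).lipschitzWith.dist_le_mul r t) ?_) hk
      rw [Real.dist_eq, abs_of_pos (sub_pos.2 hrs.1)]
      exact (mul_le_mul_of_nonneg_left (sub_le_sub_right hrs.2 t) L.2).trans_lt hs
    _ = ρ := add_halves ρ

variable [FiniteDimensional ℝ X] [l.NeBot]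

theorem deriv_mem_of_tendsto (hF : IsHausdorffUSCOn F S) (hconv : ∀ y ∈ S, Convex ℝ (F y))
    (hclosed : ∀ y ∈ S, IsClosed (F y)) (hP : ∀ k, IsInclusionSolution F S L a (T k) (P k))
    (hT : Tendsto T l (𝓝 τ)) (hp : ∀ t, Tendsto (fun k => P k t) l (𝓝 (p t)))
    (hptS : p t ∈ S) (ht : t ∈ Ico 0 τ) (hdiff : DifferentiableAt ℝ p t) :
    deriv p t ∈ F (p t) := by
  have : CompleteSpace X := FiniteDimensional.complete ℝ X
  have hslope : Tendsto (fun s => (s - t)⁻¹ • (p s - p t)) (𝓝[>] t) (𝓝 (deriv p t)) := by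
    simpa [slope_fun_def] using
      (hasDerivWithinAt_iff_tendsto_slope' self_notMem_Ioi).1 hdiff.hasDerivAt.hasDerivWithinAt
  have hmem (ε : ℝ) (hε : 0 < ε) : deriv p t ∈ Metric.cthickening ε (F (p t)) := by
    refine Metric.isClosed_cthickening.mem_of_tendsto hslope ?_
    filter_upwards [eventually_deriv_mem_cthickening hF hP hT (hp t) hptS ht hε,
      self_mem_nhdsWithin] with s hs hts
    refine Metric.isClosed_cthickening.mem_of_tendsto
      (((hp s).sub (hp t)).const_smul (s - t)⁻¹) ?_
    filter_upwards [hs] with k hk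
    rw [← integral_deriv_of_lipschitzWith (hP k).lipschitzWith]
    exact inv_smul_integral_mem ((hconv _ hptS).cthickening ε) Metric.isClosed_cthickening hts
      (intervalIntegrable_deriv_of_lipschitzWith (hP k).lipschitzWith t s) hk
  rw [← (hclosed _ hptS).closure_eq, Metric.closure_eq_iInter_cthickening]
  exact mem_iInter₂.2 hmem

theorem IsInclusionSolution.of_tendsto (hS : IsClosed S) (hF : IsHausdorffUSCOn F S)
    (hconv : ∀ y ∈ S, Convex ℝ (F y)) (hclosed : ∀ y ∈ S, IsClosed (F y))
    (hP : ∀ k, IsInclusionSolution F S L a (T k) (P k)) (hT : Tendsto T l (𝓝 τ))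
    (hp : ∀ t, Tendsto (fun k => P k t) l (𝓝 (p t))) : IsInclusionSolution F S L a τ p := by
  have hPL (k : ι) : LipschitzWith L (P k) := (hP k).lipschitzWith
  have hpL : LipschitzWith L p := lipschitzWith_of_tendsto hPL hp
  have hpS : ∀ t ∈ Icc 0 τ, p t ∈ S := by
    intro t ht
    have hmin : Tendsto (fun k => min t (T k)) l (𝓝 t) := by
      simpa only [min_eq_left ht.2] using (tendsto_const_nhds (x := t)).min hT
    exact hS.mem_of_tendsto (tendsto_apply_of_lipschitzWith hPL (hp t) hmin)
      (.of_forall fun k => (hP k).mem _ ⟨le_min ht.1 (hP k).nonneg, min_le_right _ _⟩)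
  refine ⟨ge_of_tendsto' hT fun k => (hP k).nonneg, hpL, ?_, hpS, ?_⟩
  · exact tendsto_nhds_unique (hp 0) (by simp [(hP _).apply_zero])
  · rw [← Measure.restrict_congr_set Ioo_ae_eq_Ioc]
    filter_upwards [ae_restrict_mem measurableSet_Ioo,
      ae_restrict_of_ae hpL.ae_differentiableAt_real] with t ht hdiff
    exact deriv_mem_of_tendsto hF hconv hclosed hP hT hp (hpS t (Ioo_subset_Icc_self ht))
      (Ioo_subset_Ico_self ht) hdiff

theorem isCompact_attainableSet (hS : IsClosed S) (hF : IsHausdorffUSCOn F S)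
    (hconv : ∀ y ∈ S, Convex ℝ (F y)) (hclosed : ∀ y ∈ S, IsClosed (F y)) (M : ℝ) :
    IsCompact (attainableSet F S L a M) := by
  have : ProperSpace X := FiniteDimensional.proper ℝ X
  refine isCompact_iff_compactSpace.2 ⟨isCompact_iff_ultrafilter_le_nhds.2 fun l _ => ?_⟩
  choose hM P hP hPT using fun q : attainableSet F S L a M => q.2
  have htime (q : attainableSet F S L a M) : q.1.1 ∈ Icc 0 M := ⟨(hP q).nonneg, hM q⟩
  obtain ⟨τ, hτ, hTτ⟩ := isCompact_Icc.ultrafilter_le_nhds' (l.map fun q => q.1.1)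
    (Filter.univ_mem' (f := (l : Filter _)) htime)
  have hPL (q) : LipschitzWith L (P q) := (hP q).lipschitzWith
  obtain ⟨p, hp⟩ := exists_tendsto_of_lipschitzWith l hPL fun q => (hP q).apply_zero
  have hmem : (τ, p τ) ∈ attainableSet F S L a M :=
    ⟨hτ.2, p, .of_tendsto hS hF hconv hclosed hP hTτ hp, rfl⟩
  refine ⟨⟨_, hmem⟩, mem_univ _, tendsto_subtype_rng.2 (Tendsto.prodMk_nhds hTτ ?_)⟩
  simpa only [hPT] using tendsto_apply_of_lipschitzWith hPL (hp τ) hTτ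

end DifferentialInclusion

/-! ### Extended velocities -/

section ExtendedVelocity

variable {E W Y : Type*}

/-- The extended velocity set `{(f y u, r) | u ∈ U, g y u ≤ r}` at `y`: the epigraph, over the
velocities of the control system, of the running cost. -/
def extendedVelocity (U : Set W) (f : Y → W → E) (g : Y → W → ℝ) (y : Y) : Set (E × ℝ) :=
  {p | ∃ u ∈ U, p.1 = f y u ∧ g y u ≤ p.2}

variable [NormedAddCommGroup E] {U : Set W} {f : Y → W → E} {g : Y → W → ℝ}

theorem isClosed_extendedVelocity [TopologicalSpace W] {y : Y} (hU : IsCompact U)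
    (hf : ContinuousOn (f y) U) (hg : ContinuousOn (g y) U) :
    IsClosed (extendedVelocity U f g y) := by
  have hgraph : IsCompact ((fun w => (f y w, g y w)) '' U) :=
    hU.image_of_continuousOn (hf.prodMk hg)
  have hray : IsClosed ({0} ×ˢ Ici 0 : Set (E × ℝ)) := isClosed_singleton.prod isClosed_Ici
  convert hray.add_left_of_isCompact hgraph using 1
  ext p
  constructor
  · rintro ⟨w, hw, hp, hle⟩
    exact ⟨_, mem_image_of_mem _ hw, (0, p.2 - g y w), ⟨rfl, sub_nonneg.2 hle⟩,
      by ext1 <;> simp [hp]⟩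
  · rintro ⟨_, ⟨w, hw, rfl⟩, q, ⟨hq1, hq2⟩, rfl⟩
    rw [mem_singleton_iff] at hq1
    exact ⟨w, hw, by simp [hq1], by simpa using hq2⟩

theorem isHausdorffUSCOn_extendedVelocity [TopologicalSpace W] [TopologicalSpace Y]
    {S : Set Y} (hU : IsCompact U) (hf : ContinuousOn (Function.uncurry f) (S ×ˢ U))
    (hg : ContinuousOn (Function.uncurry g) (S ×ˢ U)) :
    IsHausdorffUSCOn (extendedVelocity U f g) S := by
  intro y hy ε hε
  have hfg : ContinuousOn (Function.uncurry fun y w => (f y w, g y w)) (S ×ˢ U) := hf.prodMk hg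
  obtain ⟨v, hv, hdist⟩ := hU.mem_uniformity_of_prod hfg hy (Metric.dist_mem_uniformity hε)
  filter_upwards [hv] with y' hy' p ⟨w, hw, hp, hle⟩
  refine Metric.mem_cthickening_of_dist_le p (f y w, p.2 + (g y w - g y' w)) ε _
    ⟨w, hw, rfl, by dsimp only; linarith⟩ ?_
  have hsnd : dist p.2 (p.2 + (g y w - g y' w)) = dist (g y' w) (g y w) := by
    rw [dist_self_add_right, Real.norm_eq_abs, dist_comm, Real.dist_eq]
  rw [Prod.dist_eq, hp, hsnd]
  exact (hdist y' hy' w hw : dist (f y' w, g y' w) (f y w, g y w) < ε).le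

theorem exists_measurable_ae_mem_extendedVelocity {α : Type*} [MeasurableSpace α] {μ : Measure α}
    [MeasurableSpace E] [BorelSpace E] [SecondCountableTopology E] [MetricSpace W]
    [MeasurableSpace W] [BorelSpace W] (hU : IsCompact U) (hne : U.Nonempty)
    {φ : α → W → E} {γ : α → W → ℝ} (hφm : ∀ w ∈ U, Measurable fun a => φ a w)
    (hγm : ∀ w ∈ U, Measurable fun a => γ a w) (hφc : ∀ a, ContinuousOn (φ a) U)
    (hγc : ∀ a, ContinuousOn (γ a) U) {v : α → E × ℝ} (hv : Measurable v)
    (hmem : ∀ᵐ a ∂μ, v a ∈ extendedVelocity U φ γ a) :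
    ∃ σ : α → W, Measurable σ ∧ (∀ a, σ a ∈ U) ∧
      ∀ᵐ a ∂μ, (v a).1 = φ a (σ a) ∧ γ a (σ a) ≤ (v a).2 := by
  have hzero (a : α) (w : W) : ‖φ a w - (v a).1‖ + max 0 (γ a w - (v a).2) = 0 ↔
      (v a).1 = φ a w ∧ γ a w ≤ (v a).2 := by
    rw [add_eq_zero_iff_of_nonneg (norm_nonneg _) (le_max_left _ _), norm_sub_eq_zero_iff,
      max_eq_left_iff, sub_nonpos, eq_comm]
  obtain ⟨σ, hσ, hσU, hσz⟩ := exists_measurable_ae_zero (μ := μ) hU hne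
    (h := fun a w => ‖φ a w - (v a).1‖ + max 0 (γ a w - (v a).2))
    (fun w hw => ((hφm w hw).sub hv.fst).norm.add
      (measurable_const.max ((hγm w hw).sub hv.snd)))
    (fun a => ((hφc a).sub continuousOn_const).norm.add
      (continuousOn_const.sup ((hγc a).sub continuousOn_const)))
    (by filter_upwards [hmem] with a ⟨w, hw, hvw⟩ using ⟨w, hw, (hzero a w).2 hvw⟩)
  exact ⟨σ, hσ, hσU, hσz.mono fun a => (hzero a _).1⟩

end ExtendedVelocity

/-! ### Trajectories -/

variable {n m : ℕ} {U : Set (EuclideanSpace ℝ (Fin m))} {G G₁ K : Set (EuclideanSpace ℝ (Fin n))}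
  {f : EuclideanSpace ℝ (Fin n) → EuclideanSpace ℝ (Fin m) → EuclideanSpace ℝ (Fin n)}
  {g : EuclideanSpace ℝ (Fin n) → EuclideanSpace ℝ (Fin m) → ℝ} {c : ℝ}
  {u : ℝ → EuclideanSpace ℝ (Fin m)} {x₀ : EuclideanSpace ℝ (Fin n)}
  {x z : ℝ → EuclideanSpace ℝ (Fin n)} {T : ℝ}

theorem IsTrajectory.mono {I J : Set ℝ} (hx : IsTrajectory G₁ f u x₀ I x) (h : J ⊆ I) :
    IsTrajectory G₁ f u x₀ J x := fun t ht => hx t (h ht)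

theorem IsTrajectory.apply_zero {I : Set ℝ} (hx : IsTrajectory G₁ f u x₀ I x)
    (h : (0 : ℝ) ∈ I) : x 0 = x₀ := by
  simpa using (hx 0 h).2.2

theorem IsTrajectory.continuousOn (hx : IsTrajectory G₁ f u x₀ (Icc 0 T) x) (hT : 0 ≤ T) :
    ContinuousOn x (Icc 0 T) := by
  have hprim : ContinuousOn (fun t => ∫ s in (0 : ℝ)..t, f (x s) (u s)) (uIcc 0 T) :=
    intervalIntegral.continuousOn_primitive_interval' (hx T ⟨hT, le_rfl⟩).2.1 left_mem_uIcc
  rw [uIcc_of_le hT] at hprim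
  exact (continuousOn_const.add hprim).congr fun t ht => (hx t ht).2.2

theorem IsTrajectory.ae_hasDerivAt (hx : IsTrajectory G₁ f u x₀ (Icc 0 T) x) (hT : 0 ≤ T) :
    ∀ᵐ t ∂volume.restrict (Ioo 0 T), HasDerivAt x (f (x t) (u t)) t := by
  filter_upwards [ae_restrict_mem measurableSet_Ioo, ae_restrict_of_ae
    (hx T ⟨hT, le_rfl⟩).2.1.ae_hasDerivAt_integral] with t ht hprim
  have htT : t ∈ uIcc 0 T := by rw [uIcc_of_le hT]; exact Ioo_subset_Icc_self ht
  refine ((hprim htT 0 left_mem_uIcc).const_add x₀).congr_of_eventuallyEq ?_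
  filter_upwards [Icc_mem_nhds ht.1 ht.2] with s hs using (hx s hs).2.2

theorem IsTrajectory.exists_lipschitzOnWith (hx : IsTrajectory G₁ f u x₀ (Icc 0 T) x)
    (hU : IsCompact U) (hf : ContinuousOn (Function.uncurry f) (G₁ ×ˢ U)) (hu : IsControl U u)
    (hT : 0 ≤ T) : ∃ L, LipschitzOnWith L x (Icc 0 T) := by
  have hxG : x '' Icc 0 T ⊆ G₁ := image_subset_iff.2 fun t ht => (hx t ht).1
  have hxc : IsCompact (x '' Icc 0 T) := isCompact_Icc.image_of_continuousOn (hx.continuousOn hT)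
  obtain ⟨B, hB⟩ := (hxc.prod hU).exists_bound_of_continuousOn (hf.mono (prod_mono hxG le_rfl))
  refine ⟨B.toNNReal, LipschitzOnWith.of_dist_le_mul fun s hs t ht => ?_⟩
  rw [dist_eq_norm, (hx s hs).2.2, (hx t ht).2.2, add_sub_add_left_eq_sub,
    intervalIntegral.integral_interval_sub_left (hx s hs).2.1 (hx t ht).2.1, Real.dist_eq]
  refine intervalIntegral.norm_integral_le_of_norm_le_const fun r hr => ?_
  have hr' : r ∈ Icc 0 T := ordConnected_Icc.uIcc_subset ht hs (uIoc_subset_uIcc hr)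
  exact (hB (x r, u r) ⟨mem_image_of_mem x hr', hu.1 r hr'.1⟩).trans (Real.le_coe_toNNReal B)

theorem IsTrajectory.le_mul_exp (hx : IsTrajectory G₁ f u x₀ (Icc 0 T) x)
    (hsys : SystemAssumption U G G₁ f) (hu : IsControl U u) (hT : 0 ≤ T)
    {Y : EuclideanSpace ℝ (Fin n) → ℝ} (hY : ContDiffOn ℝ 1 Y G₁) {C : ℝ}
    (hYf : ∀ x ∈ G₁, ∀ w ∈ U, fderiv ℝ Y x (f x w) ≤ C * Y x) :
    Y (x T) ≤ Y x₀ * Real.exp (C * T) := by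
  have hYat (y) (hy : y ∈ G₁) : ContDiffAt ℝ 1 Y y :=
    hY.contDiffAt (hsys.domain_G₁.1.mem_nhds hy)
  have hxG : x '' Icc 0 T ⊆ G₁ := image_subset_iff.2 fun t ht => (hx t ht).1
  obtain ⟨L, hL⟩ := hx.exists_lipschitzOnWith hsys.isCompact_U hsys.continuousOn_f hu hT
  have hYloc : LocallyLipschitzOn (x '' Icc 0 T) Y := fun y hy =>
    let ⟨k, s, hs, hk⟩ := (hYat y (hxG hy)).exists_lipschitzOnWith
    ⟨k, s, mem_nhdsWithin_of_mem_nhds hs, hk⟩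
  obtain ⟨k, hk⟩ := hYloc.exists_lipschitzOnWith_of_compact
    (isCompact_Icc.image_of_continuousOn (hx.continuousOn hT))
  have hac : AbsolutelyContinuousOnInterval (Y ∘ x) 0 T := by
    refine LipschitzOnWith.absolutelyContinuousOnInterval (K := k * L) ?_
    rw [uIcc_of_le hT]
    exact hk.comp hL (mapsTo_image x _)
  have hle := le_mul_exp_of_ae_deriv_le (C := C) hT hac <| by
    filter_upwards [hx.ae_hasDerivAt hT, ae_restrict_mem measurableSet_Ioo] with t hxt ht
    have hmem := (hx t (Ioo_subset_Icc_self ht)).1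
    have hYt := ((hYat _ hmem).differentiableAt one_ne_zero).hasFDerivAt
    rw [(hYt.comp_hasDerivAt t hxt).deriv]
    exact hYf _ hmem _ (hu.1 t ht.1.le)
  simpa [hx.apply_zero ⟨le_rfl, hT⟩] using hle

theorem IsTrajectory.mem_of_mem_Ico (hx : IsTrajectory G₁ f u x₀ (Icc 0 T) x)
    (hsys : SystemAssumption U G G₁ f) (hu : IsControl U u) (hx₀ : x₀ ∈ G) {t : ℝ}
    (ht : t ∈ Ico 0 T) : x t ∈ G :=
  hsys.invariant u hu x₀ hx₀ T (ht.1.trans_lt ht.2) x (hx.mono Ico_subset_Icc_self) t ht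

theorem IsTrajectory.mem_closure (hx : IsTrajectory G₁ f u x₀ (Icc 0 T) x)
    (hsys : SystemAssumption U G G₁ f) (hu : IsControl U u) (hx₀ : x₀ ∈ G) (hT : 0 ≤ T) :
    x T ∈ closure G := by
  rcases hT.eq_or_lt with rfl | hT'
  · rw [hx.apply_zero ⟨le_rfl, le_rfl⟩]
    exact subset_closure hx₀
  · have hcl : T ∈ closure (Ico 0 T) := by
      rw [closure_Ico hT'.ne]
      exact ⟨hT, le_rfl⟩
    have hcont : ContinuousWithinAt x (Ico 0 T) T :=
      (hx.continuousOn hT T ⟨hT, le_rfl⟩).mono Ico_subset_Icc_self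
    exact hcont.mem_closure hcl fun t => hx.mem_of_mem_Ico hsys hu hx₀

theorem exists_isCompact_forall_trajectory (hsys : SystemAssumption U G G₁ f) (hx₀ : x₀ ∈ G)
    (M : ℝ) : ∃ Z, IsCompact Z ∧ Z ⊆ closure G ∧ ∀ u T x, IsControl U u → T ≤ M →
      IsTrajectory G₁ f u x₀ (Icc 0 T) x → ∀ t ∈ Icc 0 T, x t ∈ Z := by
  obtain ⟨Y, hY, hY0, hYp, C, hC, hYf⟩ := hsys.growth
  refine ⟨(G₁ ∩ Y ⁻¹' Icc 0 (Y x₀ * Real.exp (C * M))) ∩ closure G,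
    (hYp _ isCompact_Icc).inter_right isClosed_closure, inter_subset_right, ?_⟩
  intro u T x hu hTM hx t ht
  have hxt : IsTrajectory G₁ f u x₀ (Icc 0 t) x := hx.mono (Icc_subset_Icc_right ht.2)
  refine ⟨⟨(hx t ht).1, hY0 _ (hx t ht).1, ?_⟩, hxt.mem_closure hsys hu hx₀ ht.1⟩
  refine (hxt.le_mul_exp hsys hu ht.1 hY hYf).trans ?_
  have hYx₀ := hY0 x₀ (hsys.closure_subset (subset_closure hx₀))
  have htM := ht.2.trans hTM
  gcongr

theorem IsTrajectory.apply_eq (hx : IsTrajectory G₁ f u x₀ (Icc 0 T) x)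
    (hz : IsTrajectory G₁ f u x₀ (Icc 0 T) z) (hsys : SystemAssumption U G G₁ f)
    (hu : IsControl U u) (hx₀ : x₀ ∈ G) (hT : 0 ≤ T) : x T = z T := by
  obtain ⟨Z, hZ, hZG, hmem⟩ := exists_isCompact_forall_trajectory hsys hx₀ T
  obtain ⟨R, hR, hZR⟩ := hZ.isBounded.subset_closedBall_lt 0 0
  obtain ⟨C, -, hlip⟩ := hsys.lipschitz_f R hR
  have hZ' : Z ⊆ Metric.closedBall 0 R ∩ closure G := subset_inter hZR hZG
  set d := fun t => x t - z t with hd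
  have hd0 : d 0 = 0 := by
    simp [hd, hx.apply_zero ⟨le_rfl, hT⟩, hz.apply_zero ⟨le_rfl, hT⟩]
  have hac : AbsolutelyContinuousOnInterval (fun t => ‖d t‖ ^ 2) 0 T := by
    obtain ⟨L, hL⟩ := hx.exists_lipschitzOnWith hsys.isCompact_U hsys.continuousOn_f hu hT
    obtain ⟨L', hL'⟩ := hz.exists_lipschitzOnWith hsys.isCompact_U hsys.continuousOn_f hu hT
    rw [← uIcc_of_le hT] at hL hL'
    have hnorm : AbsolutelyContinuousOnInterval (fun t => ‖d t‖) 0 T :=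
      (lipschitzWith_one_norm.comp_lipschitzOnWith (hL.sub hL')).absolutelyContinuousOnInterval
    simp only [sq]
    exact hnorm.mul hnorm
  have hle := le_mul_exp_of_ae_deriv_le (C := 2 * C) hT hac <| by
    filter_upwards [hx.ae_hasDerivAt hT, hz.ae_hasDerivAt hT, ae_restrict_mem measurableSet_Ioo]
      with t hxt hzt ht
    have ht' := Ioo_subset_Icc_self ht
    have hderiv : deriv (fun t => ‖d t‖ ^ 2) t = _ := (hxt.sub hzt).norm_sq.deriv
    have hvel := hlip _ (hZ' (hmem u T x hu le_rfl hx t ht'))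
      _ (hZ' (hmem u T z hu le_rfl hz t ht')) _ (hu.1 t ht.1.le)
    calc deriv (fun t => ‖d t‖ ^ 2) t
        ≤ 2 * (‖d t‖ * ‖f (x t) (u t) - f (z t) (u t)‖) := by
          rw [hderiv]
          exact mul_le_mul_of_nonneg_left (real_inner_le_norm _ _) zero_le_two
      _ ≤ 2 * (‖d t‖ * (C * ‖d t‖)) := by gcongr
      _ = 2 * C * ‖d t‖ ^ 2 := by ring
  have hdT : ‖d T‖ ^ 2 = 0 := le_antisymm (by simpa [hd0] using hle) (sq_nonneg _)
  exact sub_eq_zero.1 (norm_eq_zero.1 (pow_eq_zero_iff two_ne_zero |>.1 hdT))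

/-! ### Exit times -/

section ExitProblem

variable {J : ℝ≥0∞}

theorem IsTrajectory.exitTime_le (hx : IsTrajectory G₁ f u x₀ (Icc 0 T) x) (hT : 0 ≤ T)
    (hxT : x T ∈ K) : exitTime G₁ f K x₀ u ≤ ENNReal.ofReal T :=
  sInf_le ⟨T, hT, rfl, x, hx, hxT⟩

theorem IsTrajectory.exists_exitTime_eq (hx : IsTrajectory G₁ f u x₀ (Icc 0 T) x)
    (hsys : SystemAssumption U G G₁ f) (hK : IsClosed K) (hu : IsControl U u) (hx₀ : x₀ ∈ G)
    (hT : 0 ≤ T) (hxT : x T ∈ K) :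
    ∃ τ ∈ Icc 0 T, exitTime G₁ f K x₀ u = ENNReal.ofReal τ ∧ x τ ∈ K := by
  have hhit : IsCompact (Icc 0 T ∩ x ⁻¹' K) :=
    isCompact_Icc.of_isClosed_subset
      ((hx.continuousOn hT).preimage_isClosed_of_isClosed isClosed_Icc hK) inter_subset_left
  obtain ⟨τ, ⟨hτ, hτK⟩, hmin⟩ := hhit.exists_isLeast ⟨T, ⟨hT, le_rfl⟩, hxT⟩
  have hxτ := hx.mono (Icc_subset_Icc_right hτ.2)
  refine ⟨τ, hτ, le_antisymm (hxτ.exitTime_le hτ.1 hτK) (le_sInf ?_), hτK⟩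
  rintro _ ⟨S, hS, rfl, z, hz, hzK⟩
  refine ENNReal.ofReal_le_ofReal (le_of_not_gt fun hlt => hlt.not_ge ?_)
  have hxz : x S = z S :=
    (hxτ.mono (Icc_subset_Icc_right hlt.le)).apply_eq hz hsys hu hx₀ hS
  exact hmin ⟨⟨hS, hlt.le.trans hτ.2⟩, show x S ∈ K from hxz ▸ hzK⟩

theorem exists_isFreeTimeCost_of_exitTime_lt_top (hu : IsControl U u)
    (h : exitTime G₁ f K x₀ u < ∞) : ∃ T J, IsFreeTimeCost U G₁ f g c K x₀ u T J := by
  obtain ⟨_, ⟨T, hT, -, x, hx, hxK⟩, -⟩ := sInf_lt_iff.1 h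
  exact ⟨T, _, hu, hT, x, hx, hxK, rfl⟩

theorem cost_mono {τ : ℝ} (h : τ ≤ T) : cost g c x u τ ≤ cost g c x u T :=
  add_le_add_left (lintegral_mono_set (Icc_subset_Icc_right h)) _

theorem IsFreeTimeCost.exists_isExitCost_le (h : IsFreeTimeCost U G₁ f g c K x₀ u T J)
    (hsys : SystemAssumption U G G₁ f) (hK : IsClosed K) (hx₀ : x₀ ∈ G) :
    ∃ J' ≤ J, IsExitCost U G₁ f g c K x₀ u J' := by
  obtain ⟨hu, hT, x, hx, hxT, rfl⟩ := h
  obtain ⟨τ, hτ, hexit, -⟩ := hx.exists_exitTime_eq hsys hK hu hx₀ hT hxT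
  refine ⟨cost g c x u τ, cost_mono hτ.2, hu, hexit ▸ ENNReal.ofReal_lt_top, x, ?_⟩
  rw [hexit, ENNReal.toReal_ofReal hτ.1]
  exact ⟨hx.mono (Icc_subset_Icc_right hτ.2), rfl⟩

theorem IsExitCost.isFreeTimeCost (h : IsExitCost U G₁ f g c K x₀ u J)
    (hsys : SystemAssumption U G G₁ f) (hK : IsClosed K) (hx₀ : x₀ ∈ G) :
    IsFreeTimeCost U G₁ f g c K x₀ u (exitTime G₁ f K x₀ u).toReal J := by
  obtain ⟨hu, hlt, x, hx, hJ⟩ := h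
  refine ⟨hu, ENNReal.toReal_nonneg, x, hx, ?_, hJ⟩
  obtain ⟨_, ⟨T, hT, -, z, hz, hzK⟩, -⟩ := sInf_lt_iff.1 hlt
  obtain ⟨τ, hτ, hexit, hτK⟩ := hz.exists_exitTime_eq hsys hK hu hx₀ hT hzK
  rw [hexit, ENNReal.toReal_ofReal hτ.1] at hx ⊢
  rwa [hx.apply_eq (hz.mono (Icc_subset_Icc_right hτ.2)) hsys hu hx₀ hτ.1]

theorem exitValue_eq_freeTimeValue (hsys : SystemAssumption U G G₁ f) (hK : IsClosed K)
    (hx₀ : x₀ ∈ G) : exitValue U G₁ f g c K x₀ = freeTimeValue U G₁ f g c K x₀ := by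
  refine le_antisymm (le_sInf ?_) (le_sInf ?_)
  · rintro J ⟨u, T, h⟩
    obtain ⟨J', hle, hJ'⟩ := h.exists_isExitCost_le hsys hK hx₀
    exact (sInf_le ⟨u, hJ'⟩ : exitValue U G₁ f g c K x₀ ≤ J').trans hle
  · rintro J ⟨u, h⟩
    exact sInf_le ⟨u, _, h.isFreeTimeCost hsys hK hx₀⟩

theorem isOptimalControl_iff (hsys : SystemAssumption U G G₁ f) (hK : IsClosed K)
    (hx₀ : x₀ ∈ G) : IsOptimalControl U G₁ f g c K x₀ u ↔
      ∃ T, IsOptimalPair U G₁ f g c K x₀ u T := by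
  unfold IsOptimalControl IsOptimalPair
  rw [← exitValue_eq_freeTimeValue hsys hK hx₀]
  refine ⟨fun h => ⟨_, h.isFreeTimeCost hsys hK hx₀⟩, fun ⟨T, h⟩ => ?_⟩
  obtain ⟨J, hle, hJ⟩ := h.exists_isExitCost_le hsys hK hx₀
  rwa [← le_antisymm hle (sInf_le ⟨u, hJ⟩)]

theorem IsExitCost.ofReal_mul_exitTime_le (h : IsExitCost U G₁ f g c K x₀ u J)
    (hsys : SystemAssumption U G G₁ f) (hx₀ : x₀ ∈ G) {C : ℝ}
    (hC : ∀ x ∈ G \ K, ∀ w ∈ U, C ≤ g x w) :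
    ENNReal.ofReal C * exitTime G₁ f K x₀ u ≤ J := by
  obtain ⟨hu, hlt, x, hx, rfl⟩ := h
  set τ := (exitTime G₁ f K x₀ u).toReal with hτ
  have hxK (t : ℝ) (ht : t ∈ Ico 0 τ) : x t ∉ K := fun htK =>
    ht.2.not_ge <| ENNReal.toReal_le_of_le_ofReal ht.1 <|
      (hx.mono (Icc_subset_Icc_right ht.2.le)).exitTime_le ht.1 htK
  calc ENNReal.ofReal C * exitTime G₁ f K x₀ u
      = ∫⁻ _ in Ico 0 τ, ENNReal.ofReal C := by simp [hτ, hlt.ne]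
    _ ≤ ∫⁻ t in Ico 0 τ, ENNReal.ofReal (g (x t) (u t)) :=
        setLIntegral_mono' measurableSet_Ico fun t ht => ENNReal.ofReal_le_ofReal <|
          hC _ ⟨hx.mem_of_mem_Ico hsys hu hx₀ ht, hxK t ht⟩ _ (hu.1 t ht.1)
    _ ≤ ∫⁻ t in Icc 0 τ, ENNReal.ofReal (g (x t) (u t)) := lintegral_mono_set Ico_subset_Icc_self
    _ ≤ cost g c x u τ := le_self_add

theorem IsFreeTimeCost.lt_top (h : IsFreeTimeCost U G₁ f g c K x₀ u T J)
    (hsys : SystemAssumption U G G₁ f) (hg : ContinuousOn (Function.uncurry g) (closure G ×ˢ U))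
    (hx₀ : x₀ ∈ G) : J < ∞ := by
  obtain ⟨hu, -, x, hx, -, rfl⟩ := h
  obtain ⟨Z, hZ, hZG, hmem⟩ := exists_isCompact_forall_trajectory hsys hx₀ T
  obtain ⟨B, hB⟩ := (hZ.prod hsys.isCompact_U).exists_bound_of_continuousOn
    (hg.mono (prod_mono hZG le_rfl))
  refine ENNReal.add_lt_top.2 ⟨?_, ENNReal.ofReal_lt_top⟩
  calc ∫⁻ t in Icc 0 T, ENNReal.ofReal (g (x t) (u t))
      ≤ ∫⁻ _ in Icc 0 T, ENNReal.ofReal B :=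
        setLIntegral_mono' measurableSet_Icc fun t ht => ENNReal.ofReal_le_ofReal <|
          (le_abs_self _).trans (hB (x t, u t) ⟨hmem u T x hu le_rfl hx t ht, hu.1 t ht.1⟩)
    _ < ∞ := by
        rw [setLIntegral_const]
        exact ENNReal.mul_lt_top ENNReal.ofReal_lt_top measure_Icc_lt_top

end ExitProblem

/-! ### Trajectories as solutions of the extended velocity inclusion -/

section Realization

variable {Z : Set (EuclideanSpace ℝ (Fin n))} {L : NNReal}
  {p : ℝ → EuclideanSpace ℝ (Fin n) × ℝ}

theorem IsControl.aestronglyMeasurable_comp {X : Type*} [NormedAddCommGroup X]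
    [SecondCountableTopology X] {S : Set (EuclideanSpace ℝ (Fin n))}
    {F : EuclideanSpace ℝ (Fin n) → EuclideanSpace ℝ (Fin m) → X} (hu : IsControl U u)
    (hF : ContinuousOn (Function.uncurry F) (S ×ˢ U)) (hS : MeasurableSet S)
    (hU : MeasurableSet U) (hx : ContinuousOn x (Icc 0 T)) (hxS : ∀ t ∈ Icc 0 T, x t ∈ S) :
    AEStronglyMeasurable (fun t => F (x t) (u t)) (volume.restrict (Icc 0 T)) := by
  have hxu : AEMeasurable (fun t => (x t, u t)) (volume.restrict (Icc 0 T)) :=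
    (hx.aestronglyMeasurable measurableSet_Icc).aemeasurable.prodMk
      (hu.2 T).aestronglyMeasurable.aemeasurable
  have hmem : ∀ᵐ q ∂(volume.restrict (Icc 0 T)).map (fun t => (x t, u t)), q ∈ S ×ˢ U := by
    refine (ae_map_iff hxu (hS.prod hU)).2 ((ae_restrict_iff' measurableSet_Icc).2 ?_)
    exact ae_of_all _ fun t ht => ⟨hxS t ht, hu.1 t ht.1⟩
  have hFm := hF.aestronglyMeasurable (hS.prod hU)
    (μ := (volume.restrict (Icc 0 T)).map fun t => (x t, u t))
  rw [Measure.restrict_eq_self_of_ae_mem hmem] at hFm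
  exact hFm.comp_aemeasurable hxu

theorem cost_eq_ofReal_integral (hg : IntegrableOn (fun t => g (x t) (u t)) (Ioc 0 T))
    (hg0 : ∀ t ∈ Ioc 0 T, 0 ≤ g (x t) (u t)) :
    cost g c x u T = ENNReal.ofReal (∫ t in Ioc 0 T, g (x t) (u t)) + ENNReal.ofReal c := by
  rw [cost, ofReal_integral_eq_lintegral_ofReal hg
    ((ae_restrict_iff' measurableSet_Ioc).2 (ae_of_all _ hg0)), restrict_Ioc_eq_restrict_Icc]

theorem IsTrajectory.exists_isInclusionSolution (hx : IsTrajectory G₁ f u x₀ (Icc 0 T) x)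
    (hsys : SystemAssumption U G G₁ f) (hu : IsControl U u) (hT : 0 ≤ T)
    (hg : ContinuousOn (Function.uncurry g) (closure G ×ˢ U))
    (hg0 : ∀ y ∈ closure G, ∀ w ∈ U, 0 ≤ g y w) (hZG : Z ⊆ closure G)
    (hxZ : ∀ t ∈ Icc 0 T, x t ∈ Z) (hL : ∀ y ∈ Z, ∀ w ∈ U, ‖(f y w, g y w)‖ ≤ L) (c : ℝ) :
    ∃ p, IsInclusionSolution (extendedVelocity U f g ∘ Prod.fst) (Z ×ˢ univ) L (x₀, 0) T p ∧
      (p T).1 = x T ∧ cost g c x u T = ENNReal.ofReal (p T).2 + ENNReal.ofReal c := by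
  set v : ℝ → EuclideanSpace ℝ (Fin n) × ℝ := fun t => (f (x t) (u t), g (x t) (u t)) with hv
  have hfg : ContinuousOn (Function.uncurry fun y w => (f y w, g y w)) (closure G ×ˢ U) :=
    (hsys.continuousOn_f.mono (prod_mono hsys.closure_subset le_rfl)).prodMk hg
  have hvm : AEStronglyMeasurable v (volume.restrict (Ioc 0 T)) :=
    (hu.aestronglyMeasurable_comp hfg isClosed_closure.measurableSet
      hsys.isCompact_U.measurableSet (hx.continuousOn hT) fun t ht => hZG (hxZ t ht)).mono_measure
        (Measure.restrict_mono Ioc_subset_Icc_self le_rfl)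
  have hvL (t : ℝ) (ht : t ∈ Ioc 0 T) : ‖v t‖ ≤ L :=
    hL _ (hxZ t (Ioc_subset_Icc_self ht)) _ (hu.1 t ht.1.le)
  have hvi : IntegrableOn v (Ioc 0 T) :=
    .of_bound measure_Ioc_lt_top hvm L ((ae_restrict_iff' measurableSet_Ioc).2 (ae_of_all _ hvL))
  obtain ⟨p, hpL, hp, hder⟩ := exists_lipschitzWith_eq_integral hvm hvL (x₀, 0)
  have hp_fst (t : ℝ) (ht : t ∈ Icc 0 T) : (p t).1 = x t := by
    rw [hp t ht, (hx t ht).2.2, intervalIntegral.integral_of_le ht.1,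
      intervalIntegral.integral_of_le ht.1, Prod.fst_add,
      fst_integral (hvi.mono_set (Ioc_subset_Ioc_right ht.2))]
  have hp_snd : (p T).2 = ∫ t in Ioc 0 T, g (x t) (u t) := by
    rw [hp T ⟨hT, le_rfl⟩, intervalIntegral.integral_of_le hT, Prod.snd_add, snd_integral hvi,
      zero_add]
  refine ⟨p, ⟨hT, hpL, by simpa using hp 0 ⟨le_rfl, hT⟩, fun t ht => ⟨?_, mem_univ _⟩, ?_⟩,
    hp_fst T ⟨hT, le_rfl⟩, ?_⟩
  · rw [hp_fst t ht]
    exact hxZ t ht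
  · filter_upwards [hder, ae_restrict_mem measurableSet_Ioc] with t hpt ht
    refine ⟨u t, hu.1 t ht.1.le, ?_⟩
    simp [hpt, hv, hp_fst t (Ioc_subset_Icc_self ht)]
  · rw [hp_snd, cost_eq_ofReal_integral hvi.snd fun t ht =>
      hg0 _ (hZG (hxZ t (Ioc_subset_Icc_self ht))) _ (hu.1 t ht.1.le)]

theorem isControl_of_measurable (hU : IsCompact U) (hu : Measurable u) (huU : ∀ t, u t ∈ U) :
    IsControl U u := by
  obtain ⟨B, hB⟩ := hU.isBounded.exists_norm_le
  exact ⟨fun t _ => huU t, fun T =>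
    memLp_top_of_bound hu.aestronglyMeasurable B (ae_of_all _ fun t => hB _ (huU t))⟩

theorem IsInclusionSolution.exists_isControl
    (hp : IsInclusionSolution (extendedVelocity U f g ∘ Prod.fst) (Z ×ˢ univ) L (x₀, 0) T p)
    (hU : IsCompact U) (hne : U.Nonempty) (hf : ContinuousOn (Function.uncurry f) (Z ×ˢ U))
    (hg : ContinuousOn (Function.uncurry g) (Z ×ˢ U)) :
    ∃ u, IsControl U u ∧ ∀ᵐ t ∂volume.restrict (Ioc 0 T),
      (deriv p t).1 = f (p t).1 (u t) ∧ g (p t).1 (u t) ≤ (deriv p t).2 := by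
  set ξ : ℝ → EuclideanSpace ℝ (Fin n) :=
    IccExtend hp.nonneg ((Icc 0 T).domRestrict fun t => (p t).1)
  have hξc : Continuous ξ :=
    (continuous_fst.comp (hp.lipschitzWith.continuous.comp continuous_subtype_val)).Icc_extend'
  have hξZ (t : ℝ) : ξ t ∈ Z := (hp.mem _ (projIcc 0 T hp.nonneg t).2).1
  have hξp (t : ℝ) (ht : t ∈ Ioc 0 T) : ξ t = (p t).1 :=
    IccExtend_of_mem _ _ (Ioc_subset_Icc_self ht)
  have measurable_apply {X : Type} [NormedAddCommGroup X] [MeasurableSpace X] [BorelSpace X]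
      {F : EuclideanSpace ℝ (Fin n) → EuclideanSpace ℝ (Fin m) → X}
      (hF : ContinuousOn (Function.uncurry F) (Z ×ˢ U)) (w) (hw : w ∈ U) :
      Measurable fun t => F (ξ t) w :=
    (hF.comp_continuous (f := fun t => (ξ t, w)) (by fun_prop) fun t => ⟨hξZ t, hw⟩).measurable
  have continuousOn_apply {X : Type} [NormedAddCommGroup X]
      {F : EuclideanSpace ℝ (Fin n) → EuclideanSpace ℝ (Fin m) → X}
      (hF : ContinuousOn (Function.uncurry F) (Z ×ˢ U)) (t : ℝ) : ContinuousOn (F (ξ t)) U :=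
    hF.comp (f := fun w => (ξ t, w)) (by fun_prop) fun w hw => ⟨hξZ t, hw⟩
  obtain ⟨u, hu, huU, hdu⟩ := exists_measurable_ae_mem_extendedVelocity
    (μ := volume.restrict (Ioc 0 T)) hU hne (measurable_apply hf) (measurable_apply hg)
    (continuousOn_apply hf) (continuousOn_apply hg) (measurable_deriv p) <| by
      filter_upwards [hp.deriv_mem, ae_restrict_mem measurableSet_Ioc] with t hpt ht
      simpa only [extendedVelocity, Function.comp_apply, hξp t ht] using hpt
  refine ⟨u, isControl_of_measurable hU hu huU, ?_⟩
  filter_upwards [hdu, ae_restrict_mem measurableSet_Ioc] with t hpt ht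
  rwa [hξp t ht] at hpt

theorem IsInclusionSolution.isTrajectory
    (hp : IsInclusionSolution (extendedVelocity U f g ∘ Prod.fst) (Z ×ˢ univ) L (x₀, 0) T p)
    (hZ : Z ⊆ G₁) (hpu : ∀ᵐ t ∂volume.restrict (Ioc 0 T), (deriv p t).1 = f (p t).1 (u t)) :
    IsTrajectory G₁ f u x₀ (Icc 0 T) fun t => (p t).1 := by
  intro t ht
  have hint := intervalIntegrable_deriv_of_lipschitzWith hp.lipschitzWith 0 t
  have hvel : (fun s => (deriv p s).1) =ᵐ[volume.restrict (Ioc 0 t)]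
      fun s => f (p s).1 (u s) :=
    ae_restrict_of_ae_restrict_of_subset (Ioc_subset_Ioc_right ht.2) hpu
  refine ⟨hZ (hp.mem t ht).1, ?_, ?_⟩
  · rw [intervalIntegrable_iff_integrableOn_Ioc_of_le ht.1] at hint ⊢
    exact hint.fst.congr hvel
  · rw [intervalIntegral.integral_of_le ht.1, ← integral_congr_ae hvel, ← fst_integral hint.1,
      ← intervalIntegral.integral_of_le ht.1, integral_deriv_of_lipschitzWith hp.lipschitzWith,
      hp.apply_zero, Prod.fst_sub, add_sub_cancel]

theorem IsInclusionSolution.cost_le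
    (hp : IsInclusionSolution (extendedVelocity U f g ∘ Prod.fst) (Z ×ˢ univ) L (x₀, 0) T p)
    (hg0 : ∀ y ∈ Z, ∀ w ∈ U, 0 ≤ g y w) (hu : IsControl U u)
    (hpu : ∀ᵐ t ∂volume.restrict (Ioc 0 T), g (p t).1 (u t) ≤ (deriv p t).2) :
    cost g c (fun t => (p t).1) u T ≤ ENNReal.ofReal (p T).2 + ENNReal.ofReal c := by
  refine add_le_add_left ?_ _
  have hint := (intervalIntegrable_deriv_of_lipschitzWith hp.lipschitzWith 0 T).1
  have hpT : (p T).2 = ∫ t in Ioc 0 T, (deriv p t).2 := by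
    rw [← snd_integral hint, ← intervalIntegral.integral_of_le hp.nonneg,
      integral_deriv_of_lipschitzWith hp.lipschitzWith, hp.apply_zero, Prod.snd_sub, sub_zero]
  have hnonneg : 0 ≤ᵐ[volume.restrict (Ioc 0 T)] fun t => (deriv p t).2 := by
    filter_upwards [hpu, ae_restrict_mem measurableSet_Ioc] with t hpt ht
    exact (hg0 _ (hp.mem t (Ioc_subset_Icc_self ht)).1 _ (hu.1 t ht.1.le)).trans hpt
  rw [hpT, ofReal_integral_eq_lintegral_ofReal hint.snd hnonneg, ← restrict_Ioc_eq_restrict_Icc]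
  exact lintegral_mono_ae (hpu.mono fun t ht => ENNReal.ofReal_le_ofReal ht)

end Realization

/-! ### Existence of optimal pairs -/

section DirectMethod

variable {Z : Set (EuclideanSpace ℝ (Fin n))} {L : NNReal} {J : ℝ≥0∞} {M : ℝ}
  {q : ℝ × EuclideanSpace ℝ (Fin n) × ℝ}

theorem isCompact_attainableSet_extendedVelocity (hU : IsCompact U) (hZ : IsClosed Z)
    (hf : ContinuousOn (Function.uncurry f) (Z ×ˢ U))
    (hg : ContinuousOn (Function.uncurry g) (Z ×ˢ U))
    (hconv : ∀ y ∈ Z, Convex ℝ (extendedVelocity U f g y)) (M : ℝ) :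
    IsCompact (attainableSet (extendedVelocity U f g ∘ Prod.fst) (Z ×ˢ univ) L (x₀, 0) M) := by
  refine isCompact_attainableSet (hZ.prod isClosed_univ)
    ((isHausdorffUSCOn_extendedVelocity hU hf hg).comp continuousOn_fst fun y hy => hy.1)
    (fun y hy => hconv _ hy.1) (fun y hy => isClosed_extendedVelocity hU ?_ ?_) M
  · exact hf.comp (f := fun w => (y.1, w)) (by fun_prop) fun w hw => ⟨hy.1, hw⟩
  · exact hg.comp (f := fun w => (y.1, w)) (by fun_prop) fun w hw => ⟨hy.1, hw⟩

theorem IsFreeTimeCost.exists_mem_attainableSet (h : IsFreeTimeCost U G₁ f g c K x₀ u T J)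
    (hsys : SystemAssumption U G G₁ f)
    (hg : ContinuousOn (Function.uncurry g) (closure G ×ˢ U))
    (hg0 : ∀ y ∈ closure G, ∀ w ∈ U, 0 ≤ g y w) (hZG : Z ⊆ closure G)
    (hxZ : ∀ u T x, IsControl U u → T ≤ M → IsTrajectory G₁ f u x₀ (Icc 0 T) x →
      ∀ t ∈ Icc 0 T, x t ∈ Z)
    (hL : ∀ y ∈ Z, ∀ w ∈ U, ‖(f y w, g y w)‖ ≤ L) (hTM : T ≤ M) :
    ∃ q ∈ attainableSet (extendedVelocity U f g ∘ Prod.fst) (Z ×ˢ univ) L (x₀, 0) M,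
      q.2.1 ∈ K ∧ J = ENNReal.ofReal q.2.2 + ENNReal.ofReal c := by
  obtain ⟨hu, hT, x, hx, hxK, rfl⟩ := h
  obtain ⟨p, hp, hpx, hcost⟩ :=
    hx.exists_isInclusionSolution hsys hu hT hg hg0 hZG (hxZ u T x hu hTM hx) hL c
  exact ⟨(T, p T), ⟨hTM, p, hp, rfl⟩, hpx ▸ hxK, hcost⟩

theorem exists_isFreeTimeCost_of_mem_attainableSet
    (hq : q ∈ attainableSet (extendedVelocity U f g ∘ Prod.fst) (Z ×ˢ univ) L (x₀, 0) M)
    (hqK : q.2.1 ∈ K) (hU : IsCompact U) (hne : U.Nonempty) (hZ : Z ⊆ G₁)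
    (hf : ContinuousOn (Function.uncurry f) (Z ×ˢ U))
    (hg : ContinuousOn (Function.uncurry g) (Z ×ˢ U)) (hg0 : ∀ y ∈ Z, ∀ w ∈ U, 0 ≤ g y w) :
    ∃ u, ∃ J ≤ ENNReal.ofReal q.2.2 + ENNReal.ofReal c,
      IsFreeTimeCost U G₁ f g c K x₀ u q.1 J := by
  obtain ⟨-, p, hp, hpq⟩ := hq
  obtain ⟨u, hu, hpu⟩ := hp.exists_isControl hU hne hf hg
  rw [← hpq] at hqK ⊢
  exact ⟨u, _, hp.cost_le hg0 hu (hpu.mono fun t ht => ht.2), hu, hp.nonneg, _,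
    hp.isTrajectory hZ (hpu.mono fun t ht => ht.1), hqK, rfl⟩

theorem IsFreeTimeCost.exists_forall_le_of_le (h : IsFreeTimeCost U G₁ f g c K x₀ u T J)
    (hsys : SystemAssumption U G G₁ f) (hK : IsClosed K)
    (hg : ContinuousOn (Function.uncurry g) (closure G ×ˢ U))
    (hg0 : ∀ y ∈ closure G, ∀ w ∈ U, 0 ≤ g y w) (hconv : ConvexityAssumption U G f g)
    (hx₀ : x₀ ∈ G) (hTM : T ≤ M) :
    ∃ u' T' J', IsFreeTimeCost U G₁ f g c K x₀ u' T' J' ∧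
      ∀ v S I, IsFreeTimeCost U G₁ f g c K x₀ v S I → S ≤ M → J' ≤ I := by
  obtain ⟨Z, hZ, hZG, hxZ⟩ := exists_isCompact_forall_trajectory hsys hx₀ M
  have hf' : ContinuousOn (Function.uncurry f) (Z ×ˢ U) :=
    hsys.continuousOn_f.mono (prod_mono (hZG.trans hsys.closure_subset) le_rfl)
  have hg' : ContinuousOn (Function.uncurry g) (Z ×ˢ U) := hg.mono (prod_mono hZG le_rfl)
  obtain ⟨B, hB⟩ := (hZ.prod hsys.isCompact_U).exists_bound_of_continuousOn (hf'.prodMk hg')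
  have hL : ∀ y ∈ Z, ∀ w ∈ U, ‖(f y w, g y w)‖ ≤ B.toNNReal := fun y hy w hw =>
    (hB (y, w) ⟨hy, hw⟩).trans (Real.le_coe_toNNReal B)
  have hA : IsCompact
      (attainableSet (extendedVelocity U f g ∘ Prod.fst) (Z ×ˢ univ) B.toNNReal (x₀, 0) M ∩
        {q | q.2.1 ∈ K}) :=
    (isCompact_attainableSet_extendedVelocity hsys.isCompact_U hZ.isClosed hf' hg'
      (fun y hy => hconv y (hZG hy)) M).inter_right (hK.preimage (by fun_prop))
  obtain ⟨q₀, hq₀, hq₀K, -⟩ := h.exists_mem_attainableSet hsys hg hg0 hZG hxZ hL hTM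
  obtain ⟨q, ⟨hq, hqK⟩, hmin⟩ := hA.exists_isMinOn ⟨q₀, hq₀, hq₀K⟩
    (f := fun q => q.2.2) (by fun_prop)
  obtain ⟨u', J', hJ', h'⟩ := exists_isFreeTimeCost_of_mem_attainableSet (c := c) hq hqK
    hsys.isCompact_U ⟨u 0, h.1.1 0 le_rfl⟩ (hZG.trans hsys.closure_subset) hf' hg'
    fun y hy => hg0 y (hZG hy)
  refine ⟨u', q.1, J', h', fun v S I hv hSM => hJ'.trans ?_⟩
  obtain ⟨r, hr, hrK, rfl⟩ := hv.exists_mem_attainableSet hsys hg hg0 hZG hxZ hL hSM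
  gcongr
  exact hmin ⟨hr, hrK⟩

theorem IsFreeTimeCost.exists_isOptimalPair (h : IsFreeTimeCost U G₁ f g c K x₀ u T J)
    (hsys : SystemAssumption U G G₁ f) (hK : IsClosed K)
    (hg : ContinuousOn (Function.uncurry g) (closure G ×ˢ U))
    (hg0 : ∀ y ∈ closure G, ∀ w ∈ U, 0 ≤ g y w)
    (hgK : ∃ C > 0, ∀ y ∈ G \ K, ∀ w ∈ U, C ≤ g y w)
    (hconv : ConvexityAssumption U G f g) (hx₀ : x₀ ∈ G) :
    ∃ u T, IsOptimalPair U G₁ f g c K x₀ u T := by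
  obtain ⟨C, hC, hgC⟩ := hgK
  have hJ := h.lt_top hsys hg hx₀
  -- a control whose exit time exceeds this horizon costs at least as much as `u`
  set M := max T (J.toReal / C)
  obtain ⟨u', T', J', h', hmin⟩ :=
    h.exists_forall_le_of_le hsys hK hg hg0 hconv hx₀ (le_max_left T (J.toReal / C))
  have hle : J' ≤ freeTimeValue U G₁ f g c K x₀ := by
    rw [← exitValue_eq_freeTimeValue hsys hK hx₀]
    refine le_sInf fun I ⟨v, hv⟩ => ?_
    obtain hexit | hexit := le_total (exitTime G₁ f K x₀ v).toReal M
    · exact hmin v _ I (hv.isFreeTimeCost hsys hK hx₀) hexit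
    · calc J' ≤ J := hmin u T J h (le_max_left _ _)
        _ = ENNReal.ofReal C * ENNReal.ofReal (J.toReal / C) := by
          rw [← ENNReal.ofReal_mul hC.le, mul_div_cancel₀ _ hC.ne', ENNReal.ofReal_toReal hJ.ne]
        _ ≤ ENNReal.ofReal C * exitTime G₁ f K x₀ v := by
          gcongr
          exact ENNReal.ofReal_le_of_le_toReal ((le_max_right _ _).trans hexit)
        _ ≤ I := hv.ofReal_mul_exitTime_le hsys hx₀ hgC
  have hval : freeTimeValue U G₁ f g c K x₀ = J' := le_antisymm (sInf_le ⟨u', T', h'⟩) hle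
  exact ⟨u', T', by rwa [IsOptimalPair, hval]⟩

end DirectMethod

/-! ### Reaching the target -/

section Lyapunov

variable {Ω : Set (EuclideanSpace ℝ (Fin n))} {V : EuclideanSpace ℝ (Fin n) → ℝ}

theorem LocalCLFAssumption.isClosed_sublevel (h : LocalCLFAssumption U G f Ω V c) :
    IsClosed (sublevel Ω V c) := by
  rw [← h.closure_strict]
  exact isClosed_closure

theorem LocalCLFAssumption.sublevel_mem_nhds_zero (h : LocalCLFAssumption U G f Ω V c) :
    sublevel Ω V c ∈ 𝓝 0 := by
  refine mem_of_superset (h.domain_strict.1.mem_nhds ⟨subset_closure h.zero_mem, ?_⟩)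
    fun y hy => ⟨hy.1, hy.2.le⟩
  rw [h.posDef_V.1]
  exact h.c_pos

end Lyapunov

theorem exists_exitTime_lt_top_of_mem_nullControllable (hx₀ : x₀ ∈ nullControllable U G G₁ f)
    (hK : K ∈ 𝓝 0) : ∃ u, IsControl U u ∧ exitTime G₁ f K x₀ u < ∞ := by
  obtain ⟨-, u, hu, x, hx, hlim⟩ := hx₀
  obtain ⟨T, hxT, hT⟩ := (((tendsto_zero_iff_norm_tendsto_zero.2 hlim).eventually hK).and
    (eventually_ge_atTop 0)).exists
  exact ⟨u, hu, ((hx.mono Icc_subset_Ici_self).exitTime_le hT hxT).trans_lt ENNReal.ofReal_lt_top⟩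

theorem CostAssumption.exists_forall_le (h : CostAssumption U G g K) :
    ∃ C > 0, ∀ y ∈ G \ K, ∀ w ∈ U, C ≤ g y w := by
  obtain ⟨C, hC, hgC⟩ := h.inf_pos
  exact ⟨C, hC, fun y hy => hgC y (sdiff_subset_sdiff_right interior_subset hy)⟩

end ExitTime

theorem theorem2p24_general {n m : ℕ}
    (U : Set (EuclideanSpace ℝ (Fin m))) (G G₁ : Set (EuclideanSpace ℝ (Fin n)))
    (f : EuclideanSpace ℝ (Fin n) → EuclideanSpace ℝ (Fin m) → EuclideanSpace ℝ (Fin n))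
    (K : Set (EuclideanSpace ℝ (Fin n))) (c : NNReal)
    (g : EuclideanSpace ℝ (Fin n) → EuclideanSpace ℝ (Fin m) → ℝ)
    (hsys : ExitTime.SystemAssumption U G G₁ f) (hK : IsClosed K)
    (hg : ContinuousOn (Function.uncurry g) (closure G ×ˢ U))
    (hg0 : ∀ x ∈ closure G, ∀ u ∈ U, 0 ≤ g x u)
    (hgK : ∃ C > 0, ∀ x ∈ G \ K, ∀ u ∈ U, C ≤ g x u)
    (hconv : ExitTime.ConvexityAssumption U G f g)
    (x₀ : EuclideanSpace ℝ (Fin n)) (hx₀ : x₀ ∈ G)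
    (hreach : ∃ u, ExitTime.IsControl U u ∧ ExitTime.exitTime G₁ f K x₀ u < ∞) :
    ExitTime.exitValue U G₁ f g c K x₀ < ∞ ∧
    ExitTime.exitValue U G₁ f g c K x₀ = ExitTime.freeTimeValue U G₁ f g c K x₀ ∧
    (∃ u, ExitTime.IsOptimalControl U G₁ f g c K x₀ u) ∧
    (∃ u T, ExitTime.IsOptimalPair U G₁ f g c K x₀ u T) ∧
    (∀ u, ExitTime.IsOptimalControl U G₁ f g c K x₀ u ↔
      ∃ T, ExitTime.IsOptimalPair U G₁ f g c K x₀ u T) := by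
  obtain ⟨u, hu, hexit⟩ := hreach
  obtain ⟨T, J, h⟩ := ExitTime.exists_isFreeTimeCost_of_exitTime_lt_top (g := g) (c := c) hu hexit
  have heq := ExitTime.exitValue_eq_freeTimeValue (g := g) (c := c) hsys hK hx₀
  have hiff := fun u => ExitTime.isOptimalControl_iff (g := g) (c := c) (u := u) hsys hK hx₀
  obtain ⟨v, S, hvS⟩ := h.exists_isOptimalPair hsys hK hg hg0 hgK hconv hx₀
  exact ⟨heq ▸ hvS.lt_top hsys hg hx₀, heq, ⟨v, (hiff v).2 ⟨S, hvS⟩⟩, ⟨v, S, hvS⟩, hiff⟩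

theorem theorem2p24 {n m : ℕ}
    (U : Set (EuclideanSpace ℝ (Fin m))) (G G₁ : Set (EuclideanSpace ℝ (Fin n)))
    (f : EuclideanSpace ℝ (Fin n) → EuclideanSpace ℝ (Fin m) → EuclideanSpace ℝ (Fin n))
    (Ω : Set (EuclideanSpace ℝ (Fin n))) (V : EuclideanSpace ℝ (Fin n) → ℝ) (c : ℝ)
    (g : EuclideanSpace ℝ (Fin n) → EuclideanSpace ℝ (Fin m) → ℝ)
    (hsys : ExitTime.SystemAssumption U G G₁ f)
    (hloc : ExitTime.LocalCLFAssumption U G f Ω V c)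
    (hcost : ExitTime.CostAssumption U G g (ExitTime.sublevel Ω V c))
    (hconv : ExitTime.ConvexityAssumption U G f g)
    (x₀ : EuclideanSpace ℝ (Fin n))
    (hx₀ : x₀ ∈ ExitTime.nullControllable U G G₁ f \ ExitTime.sublevel Ω V c) :
    ExitTime.exitValue U G₁ f g c (ExitTime.sublevel Ω V c) x₀ < ∞ ∧
    ExitTime.exitValue U G₁ f g c (ExitTime.sublevel Ω V c) x₀ =
      ExitTime.freeTimeValue U G₁ f g c (ExitTime.sublevel Ω V c) x₀ ∧
    (∃ u, ExitTime.IsOptimalControl U G₁ f g c (ExitTime.sublevel Ω V c) x₀ u) ∧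
    (∃ u T, ExitTime.IsOptimalPair U G₁ f g c (ExitTime.sublevel Ω V c) x₀ u T) ∧
    (∀ u, ExitTime.IsOptimalControl U G₁ f g c (ExitTime.sublevel Ω V c) x₀ u ↔
      ∃ T, ExitTime.IsOptimalPair U G₁ f g c (ExitTime.sublevel Ω V c) x₀ u T) :=
  theorem2p24_general U G G₁ f _ ⟨c, hloc.c_pos.le⟩ g hsys hloc.isClosed_sublevel
    hcost.continuousOn_g hcost.nonneg_g hcost.exists_forall_le hconv x₀ hx₀.1.1
    (ExitTime.exists_exitTime_lt_top_of_mem_nullControllable hx₀.1 hloc.sublevel_mem_nhds_zero)
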